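/- Let $q\ge 1$, $k\ge 0$ and $t>0$. For an integer $n\ge1$ let $\phi_n:\mathbb{R}\to\mathbb{R}$ be the unique $C^2$ solution of the Bessel equation $$\phi''(r)+(n-1)\frac{\phi'(r)}{r}+\phi(r)=0\ (r\neq0),\qquad \phi(0)=1,\ \phi'(0)=0,$$ that is, $\phi_n(r)=\sum_{m\ge0} r^{2m}\prod_{j=1}^m\frac{1}{(-2j)(n-2+2j)}$. On complex-valued differential forms on $\mathbb{R}^q$ let $d$ be the exterior derivative, $d^*$ its formal adjoint and $D=d+d^*$ the Dirac operator. Since $\phi_n$ is even, $\phi_n(tD)$ is a function of the Hodge Laplacian $D^2=-\Delta$ and preserves degrees: on smooth compactly supported forms it is multiplication of the Fourier transform by $\phi_n(2\pi t|\xi|)$, and it extends to $L^2$ forms as the closure in $L^2$. Likewise $d_t=t\,\phi_{q+2}(tD)\,d$ is defined on smooth compactly supported forms and extended to $L^2$ forms as the closure in $L^2$. For $p\in\mathbb{R}^q$ let $W_t(p)=\{x:|x-p|=t\}$ be the wave front. **Theorem (Strong Huygens).** a) For every continuous $k$-form $f\in L^2$, the form $d_tf$ is defined and has exactly one continuous representative,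 and for every $p$ the value $d_tf(p)$ depends only on the restriction $f|_{W_t(p)}$: if $f_1,f_2$ are continuous $L^2$ $k$-forms with $f_1=f_2$ at all points of $W_t(p)$, then $d_tf_1(p)=d_tf_2(p)$. b) For every $C^1$ $k$-form $f$ with $df\in L^2$, the form $\phi_q(tD)\,df$ is defined and has exactly one continuous representative, and for every $p$ its value at $p$ depends only on $f$ and its first normal derivative on $W_t(p)$: if $f_1,f_2$ are $C^1$ $k$-forms with $df_1,df_2\in L^2$ such that $f_1=f_2$ and $\partial_{x-p}f_1(x)=\partial_{x-p}f_2(x)$ at all $x\in W_t(p)$, then $\phi_q(tD)\,df_1(p)=\phi_q(tD)\,df_2(p)$. In particular it depends only on $f$ in an arbitrarily small neighbourhood of $W_t(p)$. -/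

import Mathlib

open MeasureTheory Filter Topology
open scoped FourierTransform ContDiff Laplacian

/-- The `k`-th coefficient `1 / ∏_{j=1}^{k} (-2j)(n - 2 + 2j)` (the index is shifted by one). -/
noncomputable def besselCoeff (n k : ℕ) : ℝ :=
  ∏ j ∈ Finset.range k, (-(2 * ((j : ℝ) + 1)) * ((n : ℝ) + 2 * j))⁻¹

/-- The function `φ_n(r) = ∑ₖ bₖ r^{2k}`. -/
noncomputable def besselPhi (n : ℕ) (r : ℝ) : ℝ :=
  ∑' k : ℕ, besselCoeff n k * r ^ (2 * k)

/-- `f` is a solution of `f'' + (n-1) f'/r + f = 0` with `f(0) = 1`, `f'(0) = 0`. -/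
structure IsBesselSolution (n : ℕ) (f : ℝ → ℝ) : Prop where
  contDiff : ContDiff ℝ 2 f
  ode : ∀ r : ℝ, r ≠ 0 → deriv (deriv f) r + ((n : ℝ) - 1) * (deriv f r / r) + f r = 0
  map_zero : f 0 = 1
  deriv_zero : deriv f 0 = 0

theorem hasDerivAt_powerSum {c : ℕ → ℝ} (hc : ∀ k, |c k| ≤ 1 / (k.factorial : ℝ)) (s : ℝ) :
    HasDerivAt (fun x : ℝ => ∑' k, c k * x ^ k) (∑' k : ℕ, ((k : ℝ) + 1) * c (k + 1) * s ^ k) s := by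
  set R : ℝ := |s| + 1 with hR
  have hRpos : 0 < R := by positivity
  have hu : Summable (fun k : ℕ => (k : ℝ) * R ^ (k - 1) / (k.factorial : ℝ)) := by
    rw [← summable_nat_add_iff 1]
    refine (Real.summable_pow_div_factorial R).congr fun k => ?_
    rw [Nat.factorial_succ]
    have : (k.factorial : ℝ) ≠ 0 := by positivity
    push_cast
    field_simp
  have hmem : s ∈ Metric.ball (0 : ℝ) R := by simp [hR]
  have hb : ∀ (k : ℕ), ∀ y ∈ Metric.ball (0 : ℝ) R,
      ‖c k * (k * y ^ (k - 1))‖ ≤ (k : ℝ) * R ^ (k - 1) / (k.factorial : ℝ) := by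
    intro k y hy
    have hy' : |y| ≤ R := by simpa using (mem_ball_zero_iff.1 hy).le
    rw [Real.norm_eq_abs, abs_mul, abs_mul, abs_pow, Nat.abs_cast, div_eq_mul_one_div, mul_comm]
    gcongr
    exact hc k
  have hd := hasDerivAt_tsum_of_isPreconnected (g := fun k x => c k * x ^ k)
    (g' := fun k x => c k * (k * x ^ (k - 1))) (y₀ := 0) (y := s) hu Metric.isOpen_ball
    (convex_ball (0 : ℝ) R).isPreconnected
    (fun k y _ => (hasDerivAt_pow k y).const_mul (c k)) hb (by simpa using hRpos)
    (summable_of_ne_finset_zero (s := {0}) (fun k hk => by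
      have : k ≠ 0 := by simpa using hk
      simp [this])) hmem
  refine hd.congr_deriv ?_
  have hs : Summable (fun k : ℕ => c k * (k * s ^ (k - 1))) :=
    Summable.of_norm_bounded hu (fun k => hb k s hmem)
  rw [hs.tsum_eq_zero_add]
  simp only [CharP.cast_eq_zero, zero_mul, mul_zero, zero_add, Nat.add_sub_cancel]
  exact tsum_congr fun k => by push_cast; ring

theorem abs_shift_le {c : ℕ → ℝ} (hc : ∀ k, |c k| ≤ 1 / (k.factorial : ℝ)) (k : ℕ) :
    |((k : ℝ) + 1) * c (k + 1)| ≤ 1 / (k.factorial : ℝ) := by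
  have h := hc (k + 1)
  rw [Nat.factorial_succ] at h
  rw [abs_mul, abs_of_pos (by positivity : (0 : ℝ) < (k : ℝ) + 1)]
  calc ((k : ℝ) + 1) * |c (k + 1)| ≤ ((k : ℝ) + 1) * (1 / (((k + 1) * k.factorial : ℕ) : ℝ)) := by
        gcongr
    _ = 1 / (k.factorial : ℝ) := by push_cast; field_simp

theorem summable_powerSum {c : ℕ → ℝ} (hc : ∀ k, |c k| ≤ 1 / (k.factorial : ℝ)) (s : ℝ) :
    Summable (fun k => c k * s ^ k) := by
  refine Summable.of_norm_bounded (Real.summable_pow_div_factorial |s|) fun k => ?_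
  rw [Real.norm_eq_abs, abs_mul, abs_pow, div_eq_mul_one_div, mul_comm]
  gcongr
  exact hc k

theorem besselCoeff_succ (n k : ℕ) : besselCoeff n (k + 1) =
    besselCoeff n k * (-(2 * ((k : ℝ) + 1)) * ((n : ℝ) + 2 * k))⁻¹ := by
  rw [besselCoeff, Finset.prod_range_succ]; rfl

theorem abs_besselCoeff_le {n : ℕ} (hn : 1 ≤ n) (k : ℕ) :
    |besselCoeff n k| ≤ 1 / (k.factorial : ℝ) := by
  have hn' : (1 : ℝ) ≤ n := by exact_mod_cast hn
  induction k with
  | zero => simp [besselCoeff]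
  | succ k ih =>
    rw [besselCoeff_succ, abs_mul, abs_inv, abs_mul, abs_neg,
      abs_of_pos (by positivity : (0 : ℝ) < 2 * ((k : ℝ) + 1)),
      abs_of_pos (by positivity : (0 : ℝ) < (n : ℝ) + 2 * k), Nat.factorial_succ]
    push_cast
    have h : (2 * ((k : ℝ) + 1) * ((n : ℝ) + 2 * k))⁻¹ ≤ ((k : ℝ) + 1)⁻¹ := by
      gcongr
      nlinarith [(Nat.cast_nonneg k : (0 : ℝ) ≤ k)]
    calc _ ≤ 1 / (k.factorial : ℝ) * ((k : ℝ) + 1)⁻¹ := by gcongr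
      _ = _ := by field_simp

theorem isBesselSolution_besselPhi {n : ℕ} (hn : 1 ≤ n) : IsBesselSolution n (besselPhi n) := by
  set c := besselCoeff n with hcdef
  have hn' : (1 : ℝ) ≤ n := by exact_mod_cast hn
  have hc : ∀ k, |c k| ≤ 1 / (k.factorial : ℝ) := abs_besselCoeff_le hn
  set c1 : ℕ → ℝ := fun k => ((k : ℝ) + 1) * c (k + 1) with hc1def
  have hc1 : ∀ k, |c1 k| ≤ 1 / (k.factorial : ℝ) := abs_shift_le hc
  set c2 : ℕ → ℝ := fun k => ((k : ℝ) + 1) * c1 (k + 1) with hc2def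
  have hc2 : ∀ k, |c2 k| ≤ 1 / (k.factorial : ℝ) := abs_shift_le hc1
  set F : ℝ → ℝ := fun s => ∑' k, c k * s ^ k with hF
  set F1 : ℝ → ℝ := fun s => ∑' k, c1 k * s ^ k with hF1
  set F2 : ℝ → ℝ := fun s => ∑' k, c2 k * s ^ k with hF2
  have hφ : besselPhi n = fun r => F (r ^ 2) := by
    funext r; simp only [besselPhi, hF, pow_mul]; rfl
  have dF : ∀ s, HasDerivAt F (F1 s) s := hasDerivAt_powerSum hc
  have dF1 : ∀ s, HasDerivAt F1 (F2 s) s := hasDerivAt_powerSum hc1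
  have dF2 : ∀ s, DifferentiableAt ℝ F2 s := fun s => (hasDerivAt_powerSum hc2 s).differentiableAt
  have dsq : ∀ r : ℝ, HasDerivAt (fun x : ℝ => x ^ 2) (2 * r) r := fun r => by
    simpa using hasDerivAt_pow 2 r
  have d1 : ∀ r, HasDerivAt (besselPhi n) (F1 (r ^ 2) * (2 * r)) r := fun r => by
    rw [hφ]; exact (dF (r ^ 2)).comp r (dsq r)
  have e1 : deriv (besselPhi n) = fun r => F1 (r ^ 2) * (2 * r) := funext fun r => (d1 r).deriv
  have d2 : ∀ r, HasDerivAt (fun r => F1 (r ^ 2) * (2 * r))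
      (F2 (r ^ 2) * (2 * r) * (2 * r) + F1 (r ^ 2) * 2) r := fun r => by
    have := ((dF1 (r ^ 2)).comp r (dsq r)).mul ((hasDerivAt_id r).const_mul 2)
    exact this.congr_deriv (by simp)
  have e2 : deriv (deriv (besselPhi n)) =
      fun r => F2 (r ^ 2) * (2 * r) * (2 * r) + F1 (r ^ 2) * 2 := by
    rw [e1]; exact funext fun r => (d2 r).deriv
  have cF2 : Continuous F2 := Differentiable.continuous dF2
  have cF1 : Continuous F1 := Differentiable.continuous fun s => (dF1 s).differentiableAt
  have hode : ∀ s, 4 * s * F2 s + 2 * n * F1 s + F s = 0 := by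
    intro s
    have s2 := (summable_powerSum hc2 s)
    have s1 := (summable_powerSum hc1 s)
    have s0 := (summable_powerSum hc s)
    have h2 : s * F2 s = ∑' k : ℕ, (k : ℝ) * c1 k * s ^ k := by
      have hs : Summable (fun k : ℕ => (k : ℝ) * c1 k * s ^ k) := by
        rw [← summable_nat_add_iff 1]
        refine (s2.mul_left s).congr fun k => ?_
        simp only [hc2def]; push_cast; ring
      rw [hs.tsum_eq_zero_add, hF2]
      simp only [← tsum_mul_left]
      simp only [CharP.cast_eq_zero, zero_mul, zero_add]
      exact tsum_congr fun k => by simp only [hc2def]; push_cast; ring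
    have hs : Summable (fun k : ℕ => (k : ℝ) * c1 k * s ^ k) := by
      rw [← summable_nat_add_iff 1]
      refine (s2.mul_left s).congr fun k => ?_
      simp only [hc2def]; push_cast; ring
    calc 4 * s * F2 s + 2 * n * F1 s + F s
        = 4 * (s * F2 s) + 2 * n * F1 s + F s := by ring
      _ = ∑' k : ℕ, (4 * ((k : ℝ) * c1 k * s ^ k) + 2 * n * (c1 k * s ^ k) + c k * s ^ k) := by
        rw [h2, hF1, hF, Summable.tsum_add ((hs.mul_left 4).add (s1.mul_left _)) s0,
          Summable.tsum_add (hs.mul_left 4) (s1.mul_left _), tsum_mul_left, tsum_mul_left]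
      _ = ∑' k : ℕ, (0 : ℝ) := tsum_congr fun k => by
        have h : c (k + 1) * (-(2 * ((k : ℝ) + 1)) * ((n : ℝ) + 2 * k)) = c k := by
          rw [hcdef, besselCoeff_succ, mul_assoc, inv_mul_cancel₀, mul_one]
          have : (0 : ℝ) < 2 * ((k : ℝ) + 1) * ((n : ℝ) + 2 * k) := by positivity
          nlinarith
        rw [← h]; simp only [hc1def]; ring
      _ = 0 := tsum_zero
  refine ⟨?_, ?_, ?_, ?_⟩
  · rw [show (2 : WithTop ℕ∞) = 1 + 1 by norm_num, contDiff_succ_iff_deriv]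
    refine ⟨fun r => (d1 r).differentiableAt, by simp, ?_⟩
    rw [contDiff_one_iff_deriv]
    refine ⟨?_, ?_⟩
    · rw [e1]; exact fun r => (d2 r).differentiableAt
    · rw [e2]; fun_prop
  · intro r hr
    rw [e2, e1, hφ]
    have := hode (r ^ 2)
    field_simp
    linear_combination this
  · simp only [besselPhi]
    rw [tsum_eq_single 0 (fun k hk => by simp [hk])]
    simp [besselCoeff]
  · rw [e1]; simp

theorem IsBesselSolution.unique {n : ℕ} (hn : 1 ≤ n) {f g : ℝ → ℝ} (hf : IsBesselSolution n f)
    (hg : IsBesselSolution n g) : f = g := by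
  have hn' : (0 : ℝ) ≤ (n : ℝ) - 1 := by
    have : (1 : ℝ) ≤ n := by exact_mod_cast hn
    linarith
  have hw : ∀ {h : ℝ → ℝ}, IsBesselSolution n h →
      (∀ r, HasDerivAt h (deriv h r) r) ∧ (∀ r, HasDerivAt (deriv h) (deriv (deriv h) r) r) := by
    intro h hh
    have h1 : ContDiff ℝ (1 + 1) h := by
      have := hh.contDiff
      rwa [show (2 : WithTop ℕ∞) = 1 + 1 by norm_num] at this
    rw [contDiff_succ_iff_deriv] at h1
    exact ⟨fun r => (h1.1 r).hasDerivAt,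
      fun r => ((h1.2.2.differentiable one_ne_zero) r).hasDerivAt⟩
  set w : ℝ → ℝ := fun r => f r - g r
  set w1 : ℝ → ℝ := fun r => deriv f r - deriv g r
  set w2 : ℝ → ℝ := fun r => deriv (deriv f) r - deriv (deriv g) r
  have dw : ∀ r, HasDerivAt w (w1 r) r := fun r => ((hw hf).1 r).sub ((hw hg).1 r)
  have dw1 : ∀ r, HasDerivAt w1 (w2 r) r := fun r => ((hw hf).2 r).sub ((hw hg).2 r)
  set e : ℝ → ℝ := fun r => w1 r ^ 2 + w r ^ 2 with he
  have de : ∀ r, HasDerivAt e (2 * w1 r * (w2 r + w r)) r := fun r => by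
    have := ((dw1 r).pow 2).add ((dw r).pow 2)
    exact this.congr_deriv (by push_cast; ring)
  have e0 : e 0 = 0 := by simp [he, w, w1, hf.map_zero, hg.map_zero, hf.deriv_zero, hg.deriv_zero]
  have ode : ∀ r, r ≠ 0 → 2 * w1 r * (w2 r + w r) = -(2 * ((n : ℝ) - 1) * w1 r ^ 2 / r) := by
    intro r hr
    have h1 := hf.ode r hr
    have h2 := hg.ode r hr
    have h3 : w2 r + w r = -(((n : ℝ) - 1) * (w1 r / r)) := by
      simp only [w, w1, w2]; rw [sub_div]; linear_combination h1 - h2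
    rw [h3]; ring
  have ce : Continuous e := Differentiable.continuous fun r => (de r).differentiableAt
  have hle : ∀ r, e r ≤ 0 := by
    intro r
    rcases le_total 0 r with hr | hr
    · have : AntitoneOn e (Set.Ici 0) := by
        apply antitoneOn_of_deriv_nonpos (convex_Ici 0) ce.continuousOn
          (fun r _ => (de r).differentiableAt.differentiableWithinAt)
        intro x hx
        rw [interior_Ici] at hx
        have hx' : 0 < x := hx
        rw [(de x).deriv, ode x hx'.ne', neg_nonpos]
        positivity
      have := this (Set.mem_Ici.2 le_rfl) (Set.mem_Ici.2 hr) hr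
      linarith
    · have : MonotoneOn e (Set.Iic 0) := by
        apply monotoneOn_of_deriv_nonneg (convex_Iic 0) ce.continuousOn
          (fun r _ => (de r).differentiableAt.differentiableWithinAt)
        intro x hx
        rw [interior_Iic] at hx
        have hx' : x < 0 := hx
        rw [(de x).deriv, ode x hx'.ne, neg_nonneg]
        exact div_nonpos_of_nonneg_of_nonpos (by positivity) hx'.le
      have := this (Set.mem_Iic.2 hr) (Set.mem_Iic.2 le_rfl) hr
      linarith
  funext r
  have h : w r ^ 2 ≤ 0 := by have := hle r; simp only [he] at this; nlinarith [sq_nonneg (w1 r)]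
  have h' : w r = 0 := by simpa using le_antisymm h (sq_nonneg _)
  simpa [w, sub_eq_zero] using h'

/-- For `n ≥ 1`, `φ_n` is the unique solution of the Bessel initial value problem. -/
theorem isBesselSolution_iff {n : ℕ} (hn : 1 ≤ n) (f : ℝ → ℝ) :
    IsBesselSolution n f ↔ f = besselPhi n :=
  ⟨fun h => h.unique hn (isBesselSolution_besselPhi hn),
    fun h => h ▸ isBesselSolution_besselPhi hn⟩

/-- Euclidean space `ℝ^q`. -/
abbrev EucSpace (q : ℕ) : Type := EuclideanSpace ℝ (Fin q)

/-- Complex-valued alternating `k`-forms on `ℝ^q`: the values of differential `k`-forms. -/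
abbrev KForm (q k : ℕ) : Type := EucSpace q [⋀^Fin k]→L[ℝ] ℂ

/-- The codifferential `d* = -∑ᵢ ι_{eᵢ} ∂_{eᵢ}` of flat space, the formal adjoint of the exterior
derivative `extDeriv`. -/
noncomputable def codiff {q k : ℕ} (f : EucSpace q → KForm q (k + 1)) (x : EucSpace q) :
    KForm q k :=
  -∑ i : Fin q, (fderiv ℝ f x (EuclideanSpace.basisFun (Fin q) ℝ i)).curryLeft
    (EuclideanSpace.basisFun (Fin q) ℝ i)

/-- The Dirac operator `D = d + d*` on forms of mixed degree, given by their homogeneous parts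
(the parts of degree `k > q` vanish). -/
noncomputable def dirac {q : ℕ} (f : ∀ k : ℕ, EucSpace q → KForm q k) :
    ∀ k : ℕ, EucSpace q → KForm q k
  | 0 => codiff (f 1)
  | k + 1 => extDeriv (f k) + codiff (f (k + 2))

noncomputable def traceCLM {E G H ι : Type*} [NormedAddCommGroup E] [NormedSpace ℝ E]
    [NormedAddCommGroup G] [NormedSpace ℝ G] [NormedAddCommGroup H] [NormedSpace ℝ H] [Fintype ι]
    (e : ι → E) (c : G →L[ℝ] (E →L[ℝ] H)) : (E →L[ℝ] G) →L[ℝ] H :=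
  -∑ i, (ContinuousLinearMap.apply ℝ H (e i)) ∘L c ∘L (ContinuousLinearMap.apply ℝ G (e i))

theorem traceCLM_apply {E G H ι : Type*} [NormedAddCommGroup E] [NormedSpace ℝ E]
    [NormedAddCommGroup G] [NormedSpace ℝ G] [NormedAddCommGroup H] [NormedSpace ℝ H] [Fintype ι]
    (e : ι → E) (c : G →L[ℝ] (E →L[ℝ] H)) (B : E →L[ℝ] G) :
    traceCLM e c B = -∑ i, c (B (e i)) (e i) := by
  simp [traceCLM]

noncomputable def codiffCLM (q k : ℕ) : (EucSpace q →L[ℝ] KForm q (k + 1)) →L[ℝ] KForm q k :=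
  traceCLM (EuclideanSpace.basisFun (Fin q) ℝ)
    (ContinuousAlternatingMap.curryLeftLI (𝕜 := ℝ) (E := EucSpace q) (F := ℂ)
      (n := k)).toContinuousLinearMap

theorem codiffCLM_apply {q k : ℕ} (B : EucSpace q →L[ℝ] KForm q (k + 1)) :
    codiffCLM q k B = -∑ i : Fin q, (B (EuclideanSpace.basisFun (Fin q) ℝ i)).curryLeft
      (EuclideanSpace.basisFun (Fin q) ℝ i) :=
  traceCLM_apply _ _ B

theorem codiff_eq {q k : ℕ} (f : EucSpace q → KForm q (k + 1)) :
    codiff f = fun x => codiffCLM q k (fderiv ℝ f x) := by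
  funext x; rw [codiffCLM_apply]; rfl

theorem extDeriv_eq_clm {q k : ℕ} (f : EucSpace q → KForm q k) :
    extDeriv f = fun x => ContinuousAlternatingMap.alternatizeUncurryFinCLM ℝ (EucSpace q) ℂ
      (fderiv ℝ f x) := rfl

theorem fderiv_clm_fderiv {E G F : Type*} [NormedAddCommGroup E] [NormedSpace ℝ E]
    [NormedAddCommGroup G] [NormedSpace ℝ G] [NormedAddCommGroup F] [NormedSpace ℝ F]
    {f : E → G} (hf : ContDiff ℝ 2 f) (T : (E →L[ℝ] G) →L[ℝ] F) (x : E) :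
    HasFDerivAt (fun y => T (fderiv ℝ f y)) (T ∘L fderiv ℝ (fderiv ℝ f) x) x := by
  have h : DifferentiableAt ℝ (fderiv ℝ f) x :=
    ((hf.fderiv_right (m := 1) (by norm_num)).differentiable one_ne_zero) x
  exact T.hasFDerivAt.comp x h.hasFDerivAt

theorem fderiv_codiff {q k : ℕ} {f : EucSpace q → KForm q (k + 1)} (hf : ContDiff ℝ 2 f)
    (x : EucSpace q) :
    HasFDerivAt (codiff f) (codiffCLM q k ∘L fderiv ℝ (fderiv ℝ f) x) x := by
  rw [codiff_eq]
  exact fderiv_clm_fderiv hf _ x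

theorem fderiv_extDeriv {q k : ℕ} {f : EucSpace q → KForm q k} (hf : ContDiff ℝ 2 f)
    (x : EucSpace q) :
    HasFDerivAt (extDeriv f)
      (ContinuousAlternatingMap.alternatizeUncurryFinCLM ℝ (EucSpace q) ℂ ∘L
        fderiv ℝ (fderiv ℝ f) x) x := by
  rw [extDeriv_eq_clm]
  exact fderiv_clm_fderiv hf _ x

theorem fderiv_fderiv_comm {q k : ℕ} {f : EucSpace q → KForm q k} (hf : ContDiff ℝ 2 f)
    (x u v : EucSpace q) :
    fderiv ℝ (fderiv ℝ f) x u v = fderiv ℝ (fderiv ℝ f) x v u :=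
  (hf.contDiffAt (x := x)).isSymmSndFDerivAt (by simp) u v

theorem codiff_codiff {q k : ℕ} {f : EucSpace q → KForm q (k + 2)} (hf : ContDiff ℝ 2 f) :
    codiff (codiff f) = 0 := by
  funext x
  rw [codiff, (fderiv_codiff hf x).fderiv]
  simp only [ContinuousLinearMap.comp_apply, codiffCLM_apply]
  ext v
  simp only [ContinuousAlternatingMap.neg_apply, ContinuousAlternatingMap.sum_apply,
    ContinuousAlternatingMap.curryLeft_apply_apply, Pi.zero_apply,
    ContinuousAlternatingMap.coe_zero, Finset.sum_neg_distrib, neg_neg]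
  set e := EuclideanSpace.basisFun (Fin q) ℝ
  change ∑ a, ∑ i, fderiv ℝ (fderiv ℝ f) x (e a) (e i) (Matrix.vecCons (e i) (Matrix.vecCons (e a) v)) = 0
  have key : ∀ S : ℂ, S = -S → S = 0 := fun S h => by
    have : (2 : ℂ) * S = 0 := by linear_combination h
    simpa using this
  apply key
  nth_rewrite 1 [Finset.sum_comm]
  rw [← Finset.sum_neg_distrib]
  refine Finset.sum_congr rfl fun i _ => ?_
  rw [← Finset.sum_neg_distrib]
  refine Finset.sum_congr rfl fun j _ => ?_
  rw [fderiv_fderiv_comm hf]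
  have h := (fderiv ℝ (fderiv ℝ f) x (e i) (e j)).toAlternatingMap.map_swap
    (Matrix.vecCons (e j) (Matrix.vecCons (e i) v)) (i := 0) (j := 1) (by simp)
  simp only [ContinuousAlternatingMap.coe_toAlternatingMap] at h
  rw [← h]
  congr 1
  funext m
  refine Fin.cases ?_ (fun m => ?_) m
  · simp
  · refine Fin.cases ?_ (fun m => ?_) m
    · simp
    · have h0 : (m.succ.succ) ≠ 0 := Fin.succ_ne_zero _
      have h1 : (m.succ.succ) ≠ 1 := by
        rw [← Fin.succ_zero_eq_one]; exact fun h => Fin.succ_ne_zero _ (Fin.succ_injective _ h)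
      simp [Equiv.swap_apply_of_ne_of_ne h0 h1]

theorem curryLeft_alternatizeUncurryFin_succ {q k : ℕ}
    (B : EucSpace q →L[ℝ] KForm q (k + 1)) (e : EucSpace q) (v : Fin (k + 1) → EucSpace q) :
    (ContinuousAlternatingMap.alternatizeUncurryFin B).curryLeft e v =
      B e v - ∑ i : Fin (k + 1), (-1) ^ (i : ℕ) • (B (v i)).curryLeft e (i.removeNth v) := by
  rw [ContinuousAlternatingMap.curryLeft_apply_apply,
    ContinuousAlternatingMap.alternatizeUncurryFin_apply, Fin.sum_univ_succ, sub_eq_add_neg,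
    ← Finset.sum_neg_distrib]
  congr 1
  · simp
  · refine Finset.sum_congr rfl fun i _ => ?_
    have : i.succ.removeNth (Matrix.vecCons e v) = Matrix.vecCons e (i.removeNth v) := by
      funext m
      refine Fin.cases ?_ (fun m => ?_) m
      · simp [Fin.removeNth]
      · simp [Fin.removeNth]
    rw [this]
    simp [pow_succ]

theorem laplacian_apply_eq {q k : ℕ} (f : EucSpace q → KForm q k) (x : EucSpace q) :
    (Δ f) x = ∑ i : Fin q, fderiv ℝ (fderiv ℝ f) x (EuclideanSpace.basisFun (Fin q) ℝ i)
      (EuclideanSpace.basisFun (Fin q) ℝ i) := by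
  rw [InnerProductSpace.laplacian_eq_iteratedFDeriv_orthonormalBasis f
    (EuclideanSpace.basisFun (Fin q) ℝ)]
  simp [iteratedFDeriv_two_apply]

theorem codiff_extDeriv_zero {q : ℕ} {f : EucSpace q → KForm q 0} (hf : ContDiff ℝ 2 f) :
    codiff (extDeriv f) = -Δ f := by
  funext x
  rw [codiff, (fderiv_extDeriv hf x).fderiv, Pi.neg_apply, laplacian_apply_eq]
  simp only [ContinuousLinearMap.comp_apply]
  congr 1
  refine Finset.sum_congr rfl fun i _ => ?_
  ext v
  simp [ContinuousAlternatingMap.alternatizeUncurryFin_apply,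
    ContinuousAlternatingMap.alternatizeUncurryFinCLM_apply]

theorem hodge_succ {q k : ℕ} {f : EucSpace q → KForm q (k + 1)} (hf : ContDiff ℝ 2 f) :
    extDeriv (codiff f) + codiff (extDeriv f) = -Δ f := by
  funext x
  rw [Pi.add_apply, codiff, (fderiv_extDeriv hf x).fderiv, Pi.neg_apply, laplacian_apply_eq,
    extDeriv, (fderiv_codiff hf x).fderiv]
  simp only [ContinuousLinearMap.comp_apply,
    ContinuousAlternatingMap.alternatizeUncurryFinCLM_apply]
  ext v
  simp only [ContinuousAlternatingMap.add_apply, ContinuousAlternatingMap.neg_apply,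
    ContinuousAlternatingMap.sum_apply, curryLeft_alternatizeUncurryFin_succ,
    Finset.sum_sub_distrib]
  rw [ContinuousAlternatingMap.alternatizeUncurryFin_apply]
  simp only [ContinuousLinearMap.comp_apply, codiffCLM_apply, ContinuousAlternatingMap.neg_apply,
    ContinuousAlternatingMap.sum_apply, smul_neg, Finset.smul_sum, Finset.sum_neg_distrib]
  rw [Finset.sum_comm]
  simp only [fderiv_fderiv_comm hf x (v _)]
  ring

/-- `D²`, the Hodge Laplacian, acts as `-Δ` in each degree. -/
theorem dirac_dirac {q : ℕ} {f : ∀ k : ℕ, EucSpace q → KForm q k}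
    (hf : ∀ k, ContDiff ℝ 2 (f k)) (k : ℕ) : dirac (dirac f) k = -Δ (f k) := by
  have dext : ∀ k, Differentiable ℝ (extDeriv (f k)) := fun k x =>
    (fderiv_extDeriv (hf k) x).differentiableAt
  have dco : ∀ k, Differentiable ℝ (codiff (f (k + 1))) := fun k x =>
    (fderiv_codiff (hf (k + 1)) x).differentiableAt
  have codiff_add : ∀ {k : ℕ} {g h : EucSpace q → KForm q (k + 1)}, Differentiable ℝ g →
      Differentiable ℝ h → codiff (g + h) = codiff g + codiff h := by
    intro k g h hg hh
    funext x
    simp only [codiff_eq, Pi.add_apply, fderiv_add (hg x) (hh x), map_add]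
  have ext_add : ∀ {k : ℕ} {g h : EucSpace q → KForm q k}, Differentiable ℝ g →
      Differentiable ℝ h → extDeriv (g + h) = extDeriv g + extDeriv h := by
    intro k g h hg hh
    funext x
    exact extDeriv_add (hg x) (hh x)
  have ext_ext : ∀ k, extDeriv (extDeriv (f k)) = 0 := fun k =>
    extDeriv_extDeriv (hf k) (by simp)
  match k with
  | 0 =>
    change codiff (extDeriv (f 0) + codiff (f 2)) = _
    rw [codiff_add (dext 0) (dco 1), codiff_codiff (hf 2), add_zero, codiff_extDeriv_zero (hf 0)]
  | 1 =>
    change extDeriv (codiff (f 1)) + codiff (extDeriv (f 1) + codiff (f 3)) = _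
    rw [codiff_add (dext 1) (dco 2), codiff_codiff (hf 3), add_zero, hodge_succ (hf 1)]
  | k + 2 =>
    change extDeriv (extDeriv (f k) + codiff (f (k + 2))) +
      codiff (extDeriv (f (k + 2)) + codiff (f (k + 4))) = _
    rw [codiff_add (dext _) (dco _), codiff_codiff (hf (k + 4)), add_zero,
      ext_add (dext _) (dco _), ext_ext, zero_add, hodge_succ (hf (k + 2))]

/-- Smooth compactly supported forms. -/
def IsTestForm {q k : ℕ} (f : EucSpace q → KForm q k) : Prop :=
  ContDiff ℝ ∞ f ∧ HasCompactSupport f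

/-- The Fourier transform turns `D²` into multiplication by `(2π‖ξ‖)²`. -/
theorem fourier_dirac_dirac {q : ℕ} {f : ∀ k : ℕ, EucSpace q → KForm q k}
    (hf : ∀ k, IsTestForm (f k)) (k : ℕ) (ξ : EucSpace q) :
    𝓕 (dirac (dirac f) k) ξ = (((2 * Real.pi * ‖ξ‖) ^ 2 : ℝ) : ℂ) • 𝓕 (f k) ξ := by
  rw [dirac_dirac (fun k => (hf k).1.of_le (by norm_cast))]
  let g := (hf k).2.toSchwartzMap (hf k).1
  have hg : (g : EucSpace q → KForm q k) = f k := by funext x; simp [g]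
  have h1 : ((-Δ g : SchwartzMap (EucSpace q) (KForm q k)) : EucSpace q → KForm q k) =
      -Δ (f k) := by
    rw [← hg]; funext x
    simp [SchwartzMap.laplacian_apply]
  rw [← h1, ← hg, ← SchwartzMap.fourier_coe, ← SchwartzMap.fourier_coe,
    SchwartzMap.laplacian_eq_fourierMultiplierCLM g, SchwartzMap.fourierMultiplierCLM_apply]
  have h2 : 𝓕 (-(-(2 * Real.pi) ^ 2 • 𝓕⁻ (SchwartzMap.smulLeftCLM (KForm q k)
      (fun x : EucSpace q => ‖x‖ ^ 2) (𝓕 g)))) = (2 * Real.pi) ^ 2 •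
        (SchwartzMap.smulLeftCLM (KForm q k) (fun x : EucSpace q => ‖x‖ ^ 2) (𝓕 g)) := by
    rw [neg_smul, neg_neg, FourierTransform.fourier_smul, FourierTransform.fourier_fourierInv_eq]
  rw [h2, smul_apply, SchwartzMap.smulLeftCLM_apply_apply (by fun_prop)]
  ext v
  simp
  ring

/-- The functional calculus `φ(tD)` for an even function `φ`, on smooth compactly supported forms.
An even function of `D` is a function of `D²`, which preserves degrees and which the Fourier
transform diagonalises as `(2π‖ξ‖)²` (`fourier_dirac_dirac`); hence `φ(tD)` is multiplication by
`φ(t · 2π‖ξ‖)` on the Fourier side. -/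
noncomputable def evenDiracCalculus {q k : ℕ} (φ : ℝ → ℝ) (t : ℝ) (g : EucSpace q → KForm q k) :
    EucSpace q → KForm q k :=
  𝓕⁻ (fun ξ : EucSpace q => ((φ (t * (2 * Real.pi * ‖ξ‖)) : ℝ) : ℂ) • 𝓕 g ξ)

/-- The deformed exterior derivative `d_t = t φ_{q+2}(tD) d` on smooth compactly supported forms. -/
noncomputable def deformedExtDeriv {q k : ℕ} (t : ℝ) (f : EucSpace q → KForm q k) :
    EucSpace q → KForm q (k + 1) :=
  fun x => t • evenDiracCalculus (besselPhi (q + 2)) t (extDeriv f) x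

/-- `u` represents the value at `f ∈ L²` of the closure in `L²` of the operator `T`, which is given
on smooth compactly supported forms. For an operator that is bounded in the `L²` norm this is its
extension to the whole Hilbert space. -/
def IsL2Extension {q k l : ℕ} (T : (EucSpace q → KForm q k) → (EucSpace q → KForm q l))
    (f : EucSpace q → KForm q k) (u : EucSpace q → KForm q l) : Prop :=
  MemLp f 2 volume ∧ MemLp u 2 volume ∧
    ∃ g : ℕ → EucSpace q → KForm q k, (∀ j, IsTestForm (g j)) ∧
      Tendsto (fun j => eLpNorm (g j - f) 2 volume) atTop (𝓝 0) ∧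
      Tendsto (fun j => eLpNorm (T (g j) - u) 2 volume) atTop (𝓝 0)

/-! On test forms both operators are weighted averages over the sphere of radius `t`, so their
values at `p` see only the wave front. Write σ for the uniform probability measure on the unit
sphere. Rotation invariance makes the Fourier transform of σ satisfy the Bessel problem in dimension
q, so by uniqueness it is φ_q(|ξ|) (`isBesselSolution_sphereCos`, `sphereCos_eq_besselPhi`). Hence
φ_q(tD) is the plain spherical mean (`evenDiracCalculus_besselPhi_eq`).

Differentiating this transform in a direction v and using φ_q'(r) = -(r/q) φ_{q+2}(r), the transform
of ⟨θ,v⟩σ is i(⟨ξ,v⟩/q) φ_{q+2}(|ξ|). Up to a constant, ⟨ξ,v⟩ is the symbol of a directional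
derivative. The derivative in t φ_{q+2}(tD) d is therefore absorbed into the weight, and the
operator sends f to the mean of q θ∧f(x+tθ), which involves no derivative of f
(`fourierInv_besselPhi_mul_fourier_fderiv`, `deformedExtDeriv_eq`).

Means with a continuous weight are bounded on L² and preserve continuity. By density of test forms,
the closure of the operator at a continuous L² form is represented by the same mean, and continuous
representatives are unique (`eLpNorm_sphericalMean_le`, `IsL2Extension.eq_sphericalMean`). This
gives a). For b) the mean is applied to df: on the sphere, the values of f fix its tangential
derivatives, so together with the normal derivative they fix df there
(`fderiv_eq_zero_of_eq_zero_on_sphere`). -/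

/-! ### The uniform measure on the sphere and its symmetries. -/

/-- The rotation invariant probability measure on the unit sphere of `ℝ^q`, as a measure on `ℝ^q`:
the image of the uniform measure on the unit ball under radial projection. -/
noncomputable def sphereMeasure (q : ℕ) : Measure (EucSpace q) :=
  (ProbabilityTheory.cond volume (Metric.ball (0 : EucSpace q) 1)).map fun x => ‖x‖⁻¹ • x

theorem measurable_radialProjection (q : ℕ) :
    Measurable fun x : EucSpace q => ‖x‖⁻¹ • x := by fun_prop

instance isProbabilityMeasure_sphereMeasure (q : ℕ) : IsProbabilityMeasure (sphereMeasure q) := by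
  have : IsProbabilityMeasure (ProbabilityTheory.cond volume (Metric.ball (0 : EucSpace q) 1)) :=
    ProbabilityTheory.cond_isProbabilityMeasure_of_finite
      (Metric.measure_ball_pos volume _ one_pos).ne' measure_ball_lt_top.ne
  exact Measure.isProbabilityMeasure_map (measurable_radialProjection q).aemeasurable

theorem ae_sphereMeasure_norm_eq_one {q : ℕ} (hq : 1 ≤ q) :
    ∀ᵐ θ ∂sphereMeasure q, ‖θ‖ = 1 := by
  have : NeZero q := ⟨by omega⟩
  rw [sphereMeasure, ae_map_iff (measurable_radialProjection q).aemeasurable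
    (measurableSet_eq_fun measurable_norm measurable_const)]
  have h : ∀ᵐ x : EucSpace q, x ≠ 0 := by
    simp [ae_iff]
  filter_upwards [ProbabilityTheory.cond_absolutelyContinuous.ae_le h] with x hx
  rw [norm_smul, norm_inv, norm_norm, inv_mul_cancel₀ (norm_ne_zero_iff.2 hx)]

/-- A linear isometry preserves the uniform measure on the ball and commutes with radial projection.
-/
theorem measurePreserving_sphereMeasure {q : ℕ} (U : EucSpace q ≃ₗᵢ[ℝ] EucSpace q) :
    MeasurePreserving U (sphereMeasure q) (sphereMeasure q) := by
  refine ⟨U.continuous.measurable, ?_⟩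
  have hU : (ProbabilityTheory.cond volume (Metric.ball (0 : EucSpace q) 1)).map U =
      ProbabilityTheory.cond volume (Metric.ball (0 : EucSpace q) 1) := by
    have h := (U.measurePreserving.restrict_preimage_emb U.toMeasurableEquiv.measurableEmbedding
      (Metric.ball (0 : EucSpace q) 1)).map_eq
    rw [U.preimage_ball, map_zero] at h
    rw [ProbabilityTheory.cond, Measure.map_smul, h]
  rw [sphereMeasure, Measure.map_map U.continuous.measurable (measurable_radialProjection q)]
  conv_rhs => rw [← hU, Measure.map_map (measurable_radialProjection q) U.continuous.measurable]
  congr 1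
  funext x
  simp

theorem integral_sphereMeasure_comp {q : ℕ} {F : Type*} [NormedAddCommGroup F] [NormedSpace ℝ F]
    (U : EucSpace q ≃ₗᵢ[ℝ] EucSpace q) (g : EucSpace q → F) :
    ∫ θ, g (U θ) ∂sphereMeasure q = ∫ θ, g θ ∂sphereMeasure q :=
  (measurePreserving_sphereMeasure U).integral_comp U.toMeasurableEquiv.measurableEmbedding g

/-! ### The cosine transform of the sphere measure solves the Bessel equation. -/

/-- Differentiation under the integral sign for the oscillating integrals that occur below. -/
theorem hasDerivAt_integral_mul_sin {α : Type*} [MeasurableSpace α] {μ : Measure α}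
    [IsFiniteMeasure μ] {a b c d : α → ℝ} {M : ℝ}
    (ha : AEStronglyMeasurable a μ) (hb : AEStronglyMeasurable b μ)
    (hc : AEStronglyMeasurable c μ) (hd : AEStronglyMeasurable d μ)
    (ha' : ∀ᵐ x ∂μ, |a x| ≤ M) (hb' : ∀ᵐ x ∂μ, |b x| ≤ M) (hd' : ∀ᵐ x ∂μ, |d x| ≤ M) (s : ℝ) :
    HasDerivAt (fun s : ℝ => ∫ x, (a x + s * b x) * Real.sin (c x + s * d x) ∂μ)
      (∫ x, (b x * Real.sin (c x + s * d x) +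
        (a x + s * b x) * (d x * Real.cos (c x + s * d x))) ∂μ) s := by
  have key : ∀ᵐ x ∂μ, 0 ≤ M := by
    filter_upwards [ha'] with x hx using (abs_nonneg _).trans hx
  have habs : ∀ {x : α} {r : ℝ}, |a x| ≤ M → |b x| ≤ M → |a x + r * b x| ≤ M + |r| * M := by
    intro x r h1 h2
    refine (abs_add_le _ _).trans ?_
    rw [abs_mul]
    gcongr
  refine (hasDerivAt_integral_of_dominated_loc_of_deriv_le
    (F := fun s x => (a x + s * b x) * Real.sin (c x + s * d x))
    (F' := fun s x => b x * Real.sin (c x + s * d x) +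
        (a x + s * b x) * (d x * Real.cos (c x + s * d x)))
    -- On the unit ball around `s` the parameter satisfies |r| ≤ |s| + 1, which makes the bound
    -- uniform in `r`.
    (bound := fun _ => M + (M + (|s| + 1) * M) * M) (Metric.ball_mem_nhds s one_pos)
    (Eventually.of_forall fun r => ?_) ?_ ?_ ?_ (integrable_const _) ?_).2
  · exact (ha.add (hb.const_mul r)).mul
      (Real.continuous_sin.comp_aestronglyMeasurable (hc.add (hd.const_mul r)))
  · refine Integrable.of_bound ((ha.add (hb.const_mul s)).mul
      (Real.continuous_sin.comp_aestronglyMeasurable (hc.add (hd.const_mul s))))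
      (M + |s| * M) ?_
    filter_upwards [ha', hb'] with x h1 h2
    rw [Real.norm_eq_abs, abs_mul]
    calc _ ≤ |a x + s * b x| * 1 := by gcongr; exact Real.abs_sin_le_one _
      _ ≤ _ := by rw [mul_one]; exact habs h1 h2
  · have h := hc.add (hd.const_mul s)
    exact (hb.mul (Real.continuous_sin.comp_aestronglyMeasurable h)).add
      ((ha.add (hb.const_mul s)).mul (hd.mul (Real.continuous_cos.comp_aestronglyMeasurable h)))
  · filter_upwards [ha', hb', hd', key] with x h1 h2 h3 h0 r hr
    have hr' : |r| ≤ |s| + 1 := by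
      have h4 := abs_sub_abs_le_abs_sub r s
      have h5 : |r - s| < 1 := by simpa [Real.dist_eq] using hr
      linarith
    rw [Real.norm_eq_abs]
    refine (abs_add_le _ _).trans ?_
    rw [abs_mul, abs_mul, abs_mul]
    have h5 : |a x + r * b x| ≤ M + (|s| + 1) * M := (habs h1 h2).trans (by gcongr)
    have h6 := Real.abs_sin_le_one (c x + r * d x)
    have h7 := Real.abs_cos_le_one (c x + r * d x)
    calc _ ≤ M * 1 + (M + (|s| + 1) * M) * (M * 1) := by gcongr
      _ = _ := by ring
  · filter_upwards with x r _
    have h1 : HasDerivAt (fun s : ℝ => a x + s * b x) (b x) r := by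
      simpa using ((hasDerivAt_id r).mul_const (b x)).const_add (a x)
    have h2 : HasDerivAt (fun s : ℝ => c x + s * d x) (d x) r := by
      simpa using ((hasDerivAt_id r).mul_const (d x)).const_add (c x)
    exact (h1.mul h2.sin).congr_deriv (by ring)

theorem ae_abs_inner_le {q : ℕ} (hq : 1 ≤ q) (v : EucSpace q) :
    ∀ᵐ θ ∂sphereMeasure q, |inner ℝ θ v| ≤ ‖v‖ := by
  filter_upwards [ae_sphereMeasure_norm_eq_one hq] with θ hθ
  simpa [hθ] using abs_real_inner_le_norm θ v

/-- The reflection sending `v` to `-v` fixes `ξ`, so it changes the sign of the integrand while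
preserving the measure. -/
theorem integral_inner_mul_sin_of_orthogonal {q : ℕ} {v ξ : EucSpace q} (h : inner ℝ v ξ = 0) :
    ∫ θ, inner ℝ θ v * Real.sin (inner ℝ θ ξ) ∂sphereMeasure q = 0 := by
  set R := (ℝ ∙ v)ᗮ.reflection
  have hv : R v = -v := Submodule.reflection_orthogonalComplement_singleton_eq_neg v
  have hξ : R ξ = ξ := Submodule.reflection_mem_subspace_eq_self
    (Submodule.mem_orthogonal_singleton_iff_inner_right.2 h)
  have hsymm : ∀ x y, inner ℝ (R x) y = inner ℝ x (R y) := fun x y => by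
    rw [← R.inner_map_map x (R y), Submodule.reflection_reflection]
  have := integral_sphereMeasure_comp R fun θ => inner ℝ θ v * Real.sin (inner ℝ θ ξ)
  simp only [hsymm, hv, hξ, inner_neg_right, neg_mul, integral_neg] at this
  linarith

/-- The cosine transform of the sphere measure. -/
noncomputable def sphereCos {q : ℕ} (ξ : EucSpace q) : ℝ :=
  ∫ θ, Real.cos (inner ℝ θ ξ) ∂sphereMeasure q

/-- Vectors of equal length are exchanged by the reflection in the hyperplane orthogonal to their
difference. -/
theorem sphereCos_eq_of_norm_eq {q : ℕ} {ξ η : EucSpace q} (h : ‖ξ‖ = ‖η‖) :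
    sphereCos ξ = sphereCos η := by
  have := integral_sphereMeasure_comp ((ℝ ∙ (ξ - η))ᗮ.reflection)
    fun θ => Real.cos (inner ℝ θ η)
  rw [sphereCos, sphereCos, ← this]
  congr 1
  funext θ
  rw [← ((ℝ ∙ (ξ - η))ᗮ.reflection).inner_map_map θ ξ, Submodule.reflection_sub h]

theorem aestronglyMeasurable_inner {q : ℕ} (v : EucSpace q) :
    AEStronglyMeasurable (fun θ : EucSpace q => (inner ℝ θ v : ℝ)) (sphereMeasure q) :=
  (by fun_prop : Continuous fun θ : EucSpace q => (inner ℝ θ v : ℝ)).aestronglyMeasurable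

theorem hasDerivAt_sphereCos {q : ℕ} (hq : 1 ≤ q) (ξ v : EucSpace q) (s : ℝ) :
    HasDerivAt (fun s : ℝ => sphereCos (ξ + s • v))
      (-∫ θ, inner ℝ θ v * Real.sin (inner ℝ θ (ξ + s • v)) ∂sphereMeasure q) s := by
  -- The cosine is written as a sine shifted by π/2, with constant amplitude 1.
  have h := hasDerivAt_integral_mul_sin (μ := sphereMeasure q) (a := fun _ => 1)
    (b := fun _ => 0) (c := fun θ => inner ℝ θ ξ + Real.pi / 2) (d := fun θ => inner ℝ θ v)
    (M := max 1 ‖v‖) (by fun_prop) (by fun_prop)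
    ((aestronglyMeasurable_inner ξ).add_const _) (aestronglyMeasurable_inner v)
    (by simp) (by simp)
    (by filter_upwards [ae_abs_inner_le hq v] with θ hθ using hθ.trans (le_max_right _ _)) s
  have e : ∀ (r : ℝ) (θ : EucSpace q), inner ℝ θ ξ + Real.pi / 2 + r * inner ℝ θ v =
      inner ℝ θ (ξ + r • v) + Real.pi / 2 := fun r θ => by
    rw [inner_add_right, real_inner_smul_right]; ring
  simp only [e, Real.sin_add_pi_div_two, Real.cos_add_pi_div_two, mul_zero, add_zero, one_mul,
    zero_mul, zero_add, mul_neg, integral_neg] at h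
  exact h

theorem hasDerivAt_integral_inner_mul_sin {q : ℕ} (hq : 1 ≤ q) (v w : EucSpace q) (ξ η : EucSpace q)
    (s : ℝ) :
    HasDerivAt (fun s : ℝ => ∫ θ, inner ℝ θ (v + s • w) * Real.sin (inner ℝ θ (ξ + s • η))
        ∂sphereMeasure q)
      (∫ θ, (inner ℝ θ w * Real.sin (inner ℝ θ (ξ + s • η)) + inner ℝ θ (v + s • w) *
        (inner ℝ θ η * Real.cos (inner ℝ θ (ξ + s • η)))) ∂sphereMeasure q) s := by
  have h := hasDerivAt_integral_mul_sin (μ := sphereMeasure q)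
    (M := max ‖v‖ (max ‖w‖ ‖η‖)) (aestronglyMeasurable_inner v) (aestronglyMeasurable_inner w)
    (aestronglyMeasurable_inner ξ) (aestronglyMeasurable_inner η)
    (by filter_upwards [ae_abs_inner_le hq v] with θ hθ using hθ.trans (by simp))
    (by filter_upwards [ae_abs_inner_le hq w] with θ hθ using hθ.trans (by simp))
    (by filter_upwards [ae_abs_inner_le hq η] with θ hθ using hθ.trans (by simp)) s
  simpa only [inner_add_right, real_inner_smul_right] using h

theorem integrable_sphereMeasure_of_continuous {q : ℕ} (hq : 1 ≤ q) {F : Type*}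
    [NormedAddCommGroup F] {g : EucSpace q → F} (hg : Continuous g) :
    Integrable g (sphereMeasure q) := by
  have h : sphereMeasure q = (sphereMeasure q).restrict (Metric.sphere 0 1) := by
    refine (Measure.restrict_eq_self_of_ae_mem ?_).symm
    filter_upwards [ae_sphereMeasure_norm_eq_one hq] with θ hθ
    simpa using hθ
  rw [h]
  exact hg.continuousOn.integrableOn_compact (isCompact_sphere 0 1)

/-- An infinitesimal rotation in the plane of `u` and `v`: the vectors r v - s u and r u + s v stay
orthogonal for every s, so the integral of ⟨θ, r v - s u⟩ sin⟨θ, r u + s v⟩ vanishes identically.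
Its derivative at s = 0 is the identity. -/
theorem integral_inner_sq_mul_cos_of_orthogonal {q : ℕ} (hq : 1 ≤ q) {u v : EucSpace q}
    (hu : ‖u‖ = 1) (hv : ‖v‖ = 1) (h : inner ℝ u v = 0) (r : ℝ) :
    r * ∫ θ, inner ℝ θ v ^ 2 * Real.cos (inner ℝ θ (r • u)) ∂sphereMeasure q =
      ∫ θ, inner ℝ θ u * Real.sin (inner ℝ θ (r • u)) ∂sphereMeasure q := by
  have hd := hasDerivAt_integral_inner_mul_sin hq (r • v) (-u) (r • u) v 0
  have h0 : (fun s : ℝ => ∫ θ, inner ℝ θ (r • v + s • -u) * Real.sin (inner ℝ θ (r • u + s • v))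
      ∂sphereMeasure q) = fun _ => 0 := by
    funext s
    refine integral_inner_mul_sin_of_orthogonal ?_
    have h' : inner ℝ v u = 0 := by rw [real_inner_comm, h]
    simp [inner_add_left, inner_add_right, real_inner_smul_left, real_inner_smul_right, h, h', hu,
      hv]
    ring
  rw [h0] at hd
  have h1 := hd.unique (hasDerivAt_const 0 (0 : ℝ))
  simp only [zero_smul, add_zero, inner_neg_right, neg_mul] at h1
  rw [integral_add (integrable_sphereMeasure_of_continuous hq (by fun_prop))
    (integrable_sphereMeasure_of_continuous hq (by fun_prop)), integral_neg] at h1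
  rw [← integral_const_mul]
  have h2 : ∀ θ : EucSpace q, r * (inner ℝ θ v ^ 2 * Real.cos (inner ℝ θ (r • u))) =
      inner ℝ θ (r • v) * (inner ℝ θ v * Real.cos (inner ℝ θ (r • u))) := fun θ => by
    rw [real_inner_smul_right θ v]; ring
  simp only [h2]
  linarith

/-- Since 1 = |θ|² = ∑ⱼ ⟨θ,bⱼ⟩² on the sphere, the transform f splits into q integrals of ⟨θ,bⱼ⟩²
cos. The one with j = i is -f''; by the rotation identity each of the other q - 1 equals -f'/r. -/
theorem isBesselSolution_sphereCos {q : ℕ} (hq : 1 ≤ q) (i : Fin q) :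
    IsBesselSolution q fun r : ℝ => sphereCos (r • EuclideanSpace.basisFun (Fin q) ℝ i) := by
  set b := EuclideanSpace.basisFun (Fin q) ℝ
  set u := b i
  have d1 : ∀ r : ℝ, HasDerivAt (fun r : ℝ => sphereCos (r • u))
      (-∫ θ, inner ℝ θ u * Real.sin (inner ℝ θ (r • u)) ∂sphereMeasure q) r := fun r => by
    simpa using hasDerivAt_sphereCos hq 0 u r
  have d2 : ∀ r : ℝ, HasDerivAt (fun r : ℝ =>
      -∫ θ, inner ℝ θ u * Real.sin (inner ℝ θ (r • u)) ∂sphereMeasure q)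
      (-∫ θ, inner ℝ θ u * (inner ℝ θ u * Real.cos (inner ℝ θ (r • u))) ∂sphereMeasure q) r :=
    fun r => by
      have h := (hasDerivAt_integral_inner_mul_sin hq u 0 0 u r).fun_neg
      simp only [smul_zero, add_zero, inner_zero_right, zero_mul, zero_add] at h
      exact h
  have e1 : deriv (fun r : ℝ => sphereCos (r • u)) = fun r =>
      -∫ θ, inner ℝ θ u * Real.sin (inner ℝ θ (r • u)) ∂sphereMeasure q :=
    funext fun r => (d1 r).deriv
  have e2 : deriv (deriv fun r : ℝ => sphereCos (r • u)) = fun r =>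
      -∫ θ, inner ℝ θ u * (inner ℝ θ u * Real.cos (inner ℝ θ (r • u))) ∂sphereMeasure q := by
    rw [e1]; exact funext fun r => (d2 r).deriv
  refine ⟨?_, ?_, ?_, ?_⟩
  · rw [show (2 : WithTop ℕ∞) = 1 + 1 by norm_num, contDiff_succ_iff_deriv]
    refine ⟨fun r => (d1 r).differentiableAt, by simp, ?_⟩
    rw [contDiff_one_iff_deriv]
    refine ⟨?_, ?_⟩
    · rw [e1]; exact fun r => (d2 r).differentiableAt
    · rw [e2]
      refine (continuous_of_dominated (bound := fun _ => ‖u‖ * ‖u‖)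
        (fun r => Continuous.aestronglyMeasurable (by fun_prop)) (fun r => ?_)
        (integrable_const _) (ae_of_all _ fun θ => by fun_prop)).neg
      filter_upwards [ae_abs_inner_le hq u] with θ hθ
      rw [norm_mul, norm_mul]
      calc _ ≤ ‖u‖ * (‖u‖ * 1) := by
            gcongr
            exacts [hθ, hθ, Real.abs_cos_le_one _]
        _ = _ := by ring
  · intro r hr
    rw [e2, e1]
    have hj : ∀ j, j ≠ i → r * ∫ θ, inner ℝ θ (b j) ^ 2 * Real.cos (inner ℝ θ (r • u))
        ∂sphereMeasure q = ∫ θ, inner ℝ θ u * Real.sin (inner ℝ θ (r • u)) ∂sphereMeasure q :=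
      fun j hj => integral_inner_sq_mul_cos_of_orthogonal hq (b.norm_eq_one i) (b.norm_eq_one j)
        (b.inner_eq_zero (Ne.symm hj)) r
    set S := ∫ θ, inner ℝ θ u * Real.sin (inner ℝ θ (r • u)) ∂sphereMeasure q
    have hsum : sphereCos (r • u) =
        ∑ j, ∫ θ, inner ℝ θ (b j) ^ 2 * Real.cos (inner ℝ θ (r • u)) ∂sphereMeasure q := by
      rw [← integral_finsetSum _ fun j _ =>
        integrable_sphereMeasure_of_continuous hq (by fun_prop), sphereCos]
      refine integral_congr_ae ?_
      filter_upwards [ae_sphereMeasure_norm_eq_one hq] with θ hθ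
      rw [← Finset.sum_mul, b.sum_sq_inner_left θ, hθ]
      simp
    rw [← Finset.add_sum_erase _ _ (Finset.mem_univ i)] at hsum
    have hrest : r * ∑ j ∈ Finset.univ.erase i,
        ∫ θ, inner ℝ θ (b j) ^ 2 * Real.cos (inner ℝ θ (r • u)) ∂sphereMeasure q =
        ((q : ℝ) - 1) * S := by
      rw [Finset.mul_sum, Finset.sum_congr rfl fun j hj' => hj j (Finset.ne_of_mem_erase hj'),
        Finset.sum_const, Finset.card_erase_of_mem (Finset.mem_univ i), Finset.card_univ,
        Fintype.card_fin, nsmul_eq_mul, Nat.cast_sub hq, Nat.cast_one]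
    have hsq : ∀ θ : EucSpace q, inner ℝ θ u * (inner ℝ θ u * Real.cos (inner ℝ θ (r • u))) =
        inner ℝ θ (b i) ^ 2 * Real.cos (inner ℝ θ (r • u)) := fun θ => by ring
    simp only [hsq]
    rw [hsum]
    field_simp
    linear_combination hrest
  · simp [sphereCos]
  · rw [e1]; simp

/-- `φ_q` is the Fourier transform of the sphere measure. -/
theorem sphereCos_eq_besselPhi {q : ℕ} (hq : 1 ≤ q) (ξ : EucSpace q) :
    sphereCos ξ = besselPhi q ‖ξ‖ := by
  set i : Fin q := ⟨0, hq⟩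
  rw [← (isBesselSolution_iff hq _).1 (isBesselSolution_sphereCos hq i)]
  exact sphereCos_eq_of_norm_eq (by simp [norm_smul])

/-! ### From dimension q to q + 2: transforms of the sphere measure with linear weights. -/

/-- The coefficient form of φ_q'(r) = -(r/q) φ_{q+2}(r), with the power series taken in the variable
r². -/
theorem succ_mul_besselCoeff_succ {q : ℕ} (hq : 1 ≤ q) (k : ℕ) :
    ((k : ℝ) + 1) * besselCoeff q (k + 1) = -(2 * (q : ℝ))⁻¹ * besselCoeff (q + 2) k := by
  have hq' : (0 : ℝ) < q := by exact_mod_cast hq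
  induction k with
  | zero => simp [besselCoeff]
  | succ k ih =>
    rw [besselCoeff_succ q (k + 1), besselCoeff_succ (q + 2) k,
      ← mul_assoc _ (besselCoeff (q + 2) k), ← ih]
    push_cast
    have h1 : (q : ℝ) + 2 * (k + 1) ≠ 0 := by positivity
    have h2 : (q : ℝ) + 2 + 2 * k ≠ 0 := by positivity
    have h3 : (k : ℝ) + 1 ≠ 0 := by positivity
    have h4 : (k : ℝ) + 1 + 1 ≠ 0 := by positivity
    have h5 : (q : ℝ) + 2 + 2 * k = q + 2 * (k + 1) := by ring
    rw [h5]
    field_simp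

theorem hasDerivAt_besselPhi_norm {q : ℕ} (hq : 1 ≤ q) (ξ v : EucSpace q) :
    HasDerivAt (fun s : ℝ => besselPhi q ‖ξ + s • v‖)
      (-(inner ℝ ξ v / q * besselPhi (q + 2) ‖ξ‖)) 0 := by
  have hq' : (q : ℝ) ≠ 0 := by positivity
  have h1 : HasDerivAt (fun s : ℝ => ‖ξ + s • v‖ ^ 2) (2 * inner ℝ ξ v) 0 := by
    have : HasDerivAt (fun s : ℝ => ξ + s • v) v 0 := by
      simpa using ((hasDerivAt_id (0 : ℝ)).smul_const v).const_add ξ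
    simpa using this.norm_sq
  have h2 := (hasDerivAt_powerSum (abs_besselCoeff_le hq) (‖ξ + (0 : ℝ) • v‖ ^ 2)).comp 0 h1
  have e : ∀ n r, besselPhi n r = ∑' k, besselCoeff n k * (r ^ 2) ^ k := fun n r => by
    simp only [besselPhi, pow_mul]
  have h3 : (fun s : ℝ => besselPhi q ‖ξ + s • v‖) =
      (fun x : ℝ => ∑' k, besselCoeff q k * x ^ k) ∘ fun s : ℝ => ‖ξ + s • v‖ ^ 2 :=
    funext fun s => e _ _
  rw [h3]
  refine h2.congr_deriv ?_
  simp only [succ_mul_besselCoeff_succ hq, mul_assoc, zero_smul, add_zero]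
  rw [tsum_mul_left, e]
  field_simp

/-- Both sides are minus the derivative of the transform in the direction `v`, computed once under
the integral and once from the power series. -/
theorem integral_inner_mul_sin {q : ℕ} (hq : 1 ≤ q) (ξ v : EucSpace q) :
    ∫ θ, inner ℝ θ v * Real.sin (inner ℝ θ ξ) ∂sphereMeasure q =
      inner ℝ ξ v / q * besselPhi (q + 2) ‖ξ‖ := by
  have h := hasDerivAt_sphereCos hq ξ v 0
  simp only [sphereCos_eq_besselPhi hq, zero_smul, add_zero] at h
  exact neg_injective (h.unique (hasDerivAt_besselPhi_norm hq ξ v))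

theorem integral_sphereMeasure_of_odd {q : ℕ} {g : EucSpace q → ℝ} (hg : ∀ θ, g (-θ) = -g θ) :
    ∫ θ, g θ ∂sphereMeasure q = 0 := by
  have h := integral_sphereMeasure_comp (LinearIsometryEquiv.neg ℝ) g
  simp only [LinearIsometryEquiv.coe_neg, hg, integral_neg] at h
  exact self_eq_neg.1 h.symm

theorem integral_sphereMeasure_exp {q : ℕ} (hq : 1 ≤ q) (ξ : EucSpace q) :
    ∫ θ, Complex.exp ((inner ℝ θ ξ : ℝ) * Complex.I) ∂sphereMeasure q =
      ((besselPhi q ‖ξ‖ : ℝ) : ℂ) := by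
  simp only [Complex.exp_mul_I, ← Complex.ofReal_cos, ← Complex.ofReal_sin]
  rw [integral_add (integrable_sphereMeasure_of_continuous hq (by fun_prop))
    (integrable_sphereMeasure_of_continuous hq (by fun_prop)), integral_mul_const,
    integral_complex_ofReal, integral_complex_ofReal,
    integral_sphereMeasure_of_odd (g := fun θ => Real.sin _)
      (fun θ => by simp), ← sphereCos_eq_besselPhi hq]
  simp [sphereCos]

theorem integral_sphereMeasure_inner_mul_exp {q : ℕ} (hq : 1 ≤ q) (ξ v : EucSpace q) :
    ∫ θ, (inner ℝ θ v : ℝ) * Complex.exp ((inner ℝ θ ξ : ℝ) * Complex.I) ∂sphereMeasure q =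
      ((inner ℝ ξ v / q * besselPhi (q + 2) ‖ξ‖ : ℝ) : ℂ) * Complex.I := by
  simp only [Complex.exp_mul_I, ← Complex.ofReal_cos, ← Complex.ofReal_sin, mul_add, ← mul_assoc,
    ← Complex.ofReal_mul]
  rw [integral_add (integrable_sphereMeasure_of_continuous hq (by fun_prop))
    (integrable_sphereMeasure_of_continuous hq (by fun_prop)), integral_mul_const,
    integral_complex_ofReal, integral_complex_ofReal, integral_inner_mul_sin hq,
    integral_sphereMeasure_of_odd (g := fun θ => inner ℝ θ v * Real.cos _) (fun θ => by simp)]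
  simp

/-! ### Fourier multipliers as averages over spheres. -/

/-- Fubini: each exponential in the multiplier is a translation by t θ on the space side. The swap
is justified because `a` is integrable on the sphere and the Fourier transform of a Schwartz
function is integrable. -/
theorem fourierInv_mul_fourier_eq_integral {q : ℕ} (hq : 1 ≤ q) {F : Type*} [NormedAddCommGroup F]
    [NormedSpace ℂ F] [CompleteSpace F] (g : SchwartzMap (EucSpace q) F) {a m : EucSpace q → ℂ}
    (ha : Continuous a) (t : ℝ)
    (hm : ∀ ξ, m ξ = ∫ θ, a θ * Complex.exp ((inner ℝ θ ((2 * Real.pi * t) • ξ) : ℝ) * Complex.I)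
      ∂sphereMeasure q) (x : EucSpace q) :
    𝓕⁻ (fun ξ => m ξ • 𝓕 (g : EucSpace q → F) ξ) x =
      ∫ θ, a θ • g (x + t • θ) ∂sphereMeasure q := by
  have hĝ : 𝓕 (g : EucSpace q → F) = (𝓕 g : SchwartzMap (EucSpace q) F) :=
    (SchwartzMap.fourier_coe g).symm
  have hint : Integrable (𝓕 (g : EucSpace q → F)) := by
    rw [hĝ]; exact SchwartzMap.integrable _
  have hcont : Continuous (𝓕 (g : EucSpace q → F)) := by
    rw [hĝ]; exact SchwartzMap.continuous _
  have hinv : ∀ y, g y = ∫ ξ : EucSpace q,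
      Complex.exp (↑(2 * Real.pi * inner ℝ ξ y) * Complex.I) • 𝓕 (g : EucSpace q → F) ξ := by
    intro y
    rw [← Real.fourierInv_eq', g.continuous.fourierInv_fourier_eq g.integrable hint]
  simp only [hinv (x + _), ← integral_smul]
  rw [integral_integral_swap, Real.fourierInv_eq']
  · refine integral_congr_ae (ae_of_all _ fun ξ => ?_)
    simp only [hm, smul_smul]
    rw [integral_smul_const, ← integral_const_mul]
    congr 2
    funext θ
    rw [mul_left_comm, ← Complex.exp_add]
    congr 2
    rw [inner_add_right, real_inner_smul_right, real_inner_smul_right, real_inner_comm ξ θ]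
    push_cast
    ring
  · refine ((integrable_sphereMeasure_of_continuous hq ha).norm.mul_prod hint.norm).mono'
      (Continuous.aestronglyMeasurable (by fun_prop)) (ae_of_all _ fun z => ?_)
    simp only [Function.uncurry, norm_smul, Complex.norm_exp_ofReal_mul_I, one_mul, le_refl]

theorem abs_besselPhi_le_one {n : ℕ} (hn : 1 ≤ n) (r : ℝ) : |besselPhi n r| ≤ 1 := by
  -- The sphere used here lies in ℝ^n, whatever the ambient space of the forms; the bound is applied
  -- with n = q + 2.
  rw [← (isBesselSolution_iff hn _).1 (isBesselSolution_sphereCos hn ⟨0, hn⟩)]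
  refine (norm_integral_le_integral_norm fun θ => Real.cos (inner ℝ θ (_ : EucSpace n))).trans ?_
  calc _ ≤ ∫ _, (1 : ℝ) ∂sphereMeasure n := by
        refine integral_mono_of_nonneg (ae_of_all _ fun _ => norm_nonneg _) (integrable_const _)
          (ae_of_all _ fun _ => Real.abs_cos_le_one _)
    _ = 1 := by simp

theorem continuous_besselPhi {n : ℕ} (hn : 1 ≤ n) : Continuous (besselPhi n) :=
  (isBesselSolution_besselPhi hn).contDiff.continuous

theorem integrable_besselPhi_smul {q n : ℕ} (hn : 1 ≤ n) {F : Type*} [NormedAddCommGroup F]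
    [NormedSpace ℂ F] {h : EucSpace q → F} (hh : Integrable h) (t : ℝ) :
    Integrable fun ξ => ((besselPhi n (t * (2 * Real.pi * ‖ξ‖)) : ℝ) : ℂ) • h ξ := by
  have hc := continuous_besselPhi hn
  refine hh.norm.mono' ((Continuous.aestronglyMeasurable (by fun_prop)).smul
    hh.aestronglyMeasurable) (ae_of_all _ fun ξ => ?_)
  rw [norm_smul, Complex.norm_real]
  exact mul_le_of_le_one_left (norm_nonneg _) (abs_besselPhi_le_one hn _)

/-- Evaluation of derivatives and alternatization are bundled as real-linear maps, so compatibility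
with the complex scalars of the Fourier kernel is a separate hypothesis. -/
theorem fourier_clm_comp {q : ℕ} {F G : Type*} [NormedAddCommGroup F] [NormedSpace ℂ F]
    [NormedAddCommGroup G] [NormedSpace ℂ G] [CompleteSpace F] [CompleteSpace G]
    (A : F →L[ℝ] G) (hA : ∀ (c : ℂ) y, A (c • y) = c • A y) {h : EucSpace q → F}
    (hh : Integrable h) (ξ : EucSpace q) : 𝓕 (fun x => A (h x)) ξ = A (𝓕 h ξ) := by
  simp only [Real.fourier_eq, Circle.smul_def, ← hA]
  exact A.integral_comp_comm ((Real.fourierIntegral_convergent_iff ξ).2 hh)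

theorem fourierInv_clm_comp {q : ℕ} {F G : Type*} [NormedAddCommGroup F] [NormedSpace ℂ F]
    [NormedAddCommGroup G] [NormedSpace ℂ G] [CompleteSpace F] [CompleteSpace G]
    (A : F →L[ℝ] G) (hA : ∀ (c : ℂ) y, A (c • y) = c • A y) {h : EucSpace q → F}
    (hh : Integrable h) (x : EucSpace q) : 𝓕⁻ (fun ξ => A (h ξ)) x = A (𝓕⁻ h x) := by
  rw [Real.fourierInv_eq_fourier_neg, fourier_clm_comp A hA hh, ← Real.fourierInv_eq_fourier_neg]

theorem evenDiracCalculus_besselPhi_eq {q k : ℕ} (hq : 1 ≤ q) {t : ℝ} (ht : 0 < t)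
    {g : EucSpace q → KForm q k} (hg : IsTestForm g) :
    evenDiracCalculus (besselPhi q) t g = fun x => ∫ θ, g (x + t • θ) ∂sphereMeasure q := by
  funext x
  have h := fourierInv_mul_fourier_eq_integral hq (hg.2.toSchwartzMap hg.1)
    (a := fun _ => 1) (m := fun ξ => ((besselPhi q (t * (2 * Real.pi * ‖ξ‖)) : ℝ) : ℂ))
    continuous_const t (fun ξ => ?_) x
  · have hg' : (hg.2.toSchwartzMap hg.1 : EucSpace q → KForm q k) = g := by funext x; simp
    rw [hg'] at h
    simp only [one_smul] at h
    exact h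
  · simp only [one_mul]
    rw [integral_sphereMeasure_exp hq, norm_smul, Real.norm_of_nonneg (by positivity)]
    congr 2
    ring

/-- The symbol of the spherical mean that represents `t φ_{q+2}(tD) A ∇` for a linear operation `A`
on derivatives. -/
noncomputable def gradSymbol {q : ℕ} {F G : Type*} [NormedAddCommGroup F] [NormedSpace ℝ F]
    [NormedAddCommGroup G] [NormedSpace ℝ G] (A : (EucSpace q →L[ℝ] F) →L[ℝ] G) (θ : EucSpace q) :
    F →L[ℝ] G :=
  (q : ℝ) • (A ∘L ContinuousLinearMap.smulRightL ℝ (EucSpace q) F (innerSL ℝ θ))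

theorem continuous_gradSymbol {q : ℕ} {F G : Type*} [NormedAddCommGroup F] [NormedSpace ℝ F]
    [NormedAddCommGroup G] [NormedSpace ℝ G] (A : (EucSpace q →L[ℝ] F) →L[ℝ] G) :
    Continuous (gradSymbol A) :=
  (continuous_const.clm_comp
    ((ContinuousLinearMap.smulRightL ℝ (EucSpace q) F).continuous.comp
      (innerSL ℝ).continuous)).const_smul (q : ℝ)

/-- The derivative contributes 2πi⟨ξ,v⟩ on the Fourier side, and its product with φ_{q+2}(2πt|ξ|) is
the transform of a linear weight on the sphere. The identity is proved for the full derivative,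
direction by direction, and then pushed through `A`. -/
theorem fourierInv_besselPhi_mul_fourier_fderiv {q : ℕ} (hq : 1 ≤ q) {t : ℝ} (ht : 0 < t)
    {F W : Type*} [NormedAddCommGroup F] [NormedSpace ℂ F] [CompleteSpace F]
    [NormedAddCommGroup W] [NormedSpace ℂ W] [CompleteSpace W]
    (A : (EucSpace q →L[ℝ] F) →L[ℝ] W) (hA : ∀ (c : ℂ) B, A (c • B) = c • A B)
    (G : SchwartzMap (EucSpace q) F) (x : EucSpace q) :
    t • 𝓕⁻ (fun ξ => ((besselPhi (q + 2) (t * (2 * Real.pi * ‖ξ‖)) : ℝ) : ℂ) •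
      𝓕 (fun y => A (fderiv ℝ G y)) ξ) x =
      ∫ θ, gradSymbol A θ (G (x + t • θ)) ∂sphereMeasure q := by
  have ht' : (t : ℂ) ≠ 0 := by exact_mod_cast ht.ne'
  have hq' : (q : ℂ) ≠ 0 := by exact_mod_cast (by omega : q ≠ 0)
  set D : SchwartzMap (EucSpace q) (EucSpace q →L[ℝ] F) := SchwartzMap.fderivCLM ℝ _ _ G
  have hD : (D : EucSpace q → _) = fderiv ℝ G := rfl
  have hDi : Integrable (𝓕 (fderiv ℝ G)) := by
    rw [← hD, ← SchwartzMap.fourier_coe]; exact SchwartzMap.integrable _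
  have hI : Integrable (fun θ => (innerSL ℝ θ).smulRight (G (x + t • θ))) (sphereMeasure q) := by
    refine integrable_sphereMeasure_of_continuous hq ?_
    have h1 : Continuous fun θ : EucSpace q => G (x + t • θ) := by fun_prop
    exact ((ContinuousLinearMap.smulRightL ℝ (EucSpace q) (F)).continuous.comp
      (innerSL ℝ).continuous).clm_apply h1
  have hmi := integrable_besselPhi_smul (n := q + 2) (by omega) hDi t
  have key : t • 𝓕⁻ (fun ξ => ((besselPhi (q + 2) (t * (2 * Real.pi * ‖ξ‖)) : ℝ) : ℂ) •
      𝓕 (fderiv ℝ G) ξ) x =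
      (q : ℝ) • ∫ θ, (innerSL ℝ θ).smulRight (G (x + t • θ)) ∂sphereMeasure q := by
    refine ContinuousLinearMap.ext fun v => ?_
    have h1 := fourierInv_clm_comp (ContinuousLinearMap.apply ℝ (F) v)
      (fun c y => rfl) hmi x
    have h2 := (ContinuousLinearMap.apply ℝ (F) v).integral_comp_comm hI
    have h3 : ∀ ξ, 𝓕 (fderiv ℝ G) ξ v =
        (2 * Real.pi * Complex.I * (inner ℝ ξ v : ℝ) : ℂ) • 𝓕 (G : EucSpace q → F) ξ := by
      intro ξ
      rw [Real.fourier_fderiv G.integrable G.differentiable D.integrable]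
      simp [innerSL_apply_apply ℝ, mul_smul]
    -- At frequency 2πtξ the weight ⟨θ,v⟩ has transform i(2πt⟨ξ,v⟩/q) φ_{q+2}; the factor q/t turns
    -- this into the required multiplier. The outer factor t then leaves q⟨θ,v⟩.
    have h4 := fourierInv_mul_fourier_eq_integral hq G
      (a := fun θ => ((q * inner ℝ θ v / t : ℝ) : ℂ))
      (m := fun ξ => ((besselPhi (q + 2) (t * (2 * Real.pi * ‖ξ‖)) : ℝ) : ℂ) *
        (2 * Real.pi * Complex.I * (inner ℝ ξ v : ℝ))) (by fun_prop) t (fun ξ => by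
          have e : ∀ θ : EucSpace q, ((q * inner ℝ θ v / t : ℝ) : ℂ) = (q / t : ℝ) *
              (inner ℝ θ v : ℝ) := fun θ => by push_cast; ring
          simp only [e, mul_assoc]
          rw [integral_const_mul, integral_sphereMeasure_inner_mul_exp hq, norm_smul,
            Real.norm_of_nonneg (by positivity), real_inner_smul_left,
            show 2 * (Real.pi * t) * ‖ξ‖ = t * (2 * (Real.pi * ‖ξ‖)) by ring]
          push_cast
          field_simp) x
    simp only [ContinuousLinearMap.apply_apply, smul_apply, h3, smul_smul,
      ContinuousLinearMap.smulRight_apply] at h1 h2 ⊢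
    rw [← h1, ← h2, h4, ← integral_smul, ← integral_smul]
    congr 1
    funext θ
    rw [innerSL_apply_apply, smul_smul (q : ℝ), ← Complex.coe_smul t,
      ← Complex.coe_smul (q * inner ℝ θ v), smul_smul]
    congr 1
    push_cast
    field_simp
  have e1 : ∀ ξ, 𝓕 (fun y => A (fderiv ℝ G y)) ξ = A (𝓕 (fderiv ℝ G) ξ) :=
    fourier_clm_comp A hA (by rw [← hD]; exact D.integrable)
  simp only [e1, ← hA]
  rw [fourierInv_clm_comp A hA hmi, ← map_smul, key, map_smul,
    ← A.integral_comp_comm hI, ← integral_smul]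
  rfl

theorem alternatizeUncurryFinCLM_smul {q k : ℕ} (c : ℂ) (B : EucSpace q →L[ℝ] KForm q k) :
    ContinuousAlternatingMap.alternatizeUncurryFinCLM ℝ (EucSpace q) ℂ (c • B) =
      c • ContinuousAlternatingMap.alternatizeUncurryFinCLM ℝ (EucSpace q) ℂ B := by
  ext v
  simp [ContinuousAlternatingMap.alternatizeUncurryFinCLM_apply,
    ContinuousAlternatingMap.alternatizeUncurryFin_apply, Finset.mul_sum]

theorem deformedExtDeriv_eq {q k : ℕ} (hq : 1 ≤ q) {t : ℝ} (ht : 0 < t)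
    {g : EucSpace q → KForm q k} (hg : IsTestForm g) :
    deformedExtDeriv t g = fun x => ∫ θ, gradSymbol
      (ContinuousAlternatingMap.alternatizeUncurryFinCLM ℝ (EucSpace q) ℂ) θ (g (x + t • θ))
        ∂sphereMeasure q := by
  funext x
  have h := fourierInv_besselPhi_mul_fourier_fderiv hq ht
    (ContinuousAlternatingMap.alternatizeUncurryFinCLM ℝ (n := k) (EucSpace q) ℂ)
    alternatizeUncurryFinCLM_smul (hg.2.toSchwartzMap hg.1) x
  have hG : (hg.2.toSchwartzMap hg.1 : EucSpace q → KForm q k) = g := by funext x; simp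
  rw [hG] at h
  exact h

/-! ### Spherical means on L² and on continuous functions. -/

/-- L² limits agree almost everywhere, and Lebesgue measure charges every nonempty open set, so
continuous limits agree everywhere. -/
theorem eq_of_tendsto_eLpNorm_sub {q : ℕ} {F : Type*} [NormedAddCommGroup F]
    {u w : EucSpace q → F} (hu : Continuous u) (hw : Continuous w)
    {g : ℕ → EucSpace q → F} (hg : ∀ j, Continuous (g j))
    (h1 : Tendsto (fun j => eLpNorm (g j - u) 2 volume) atTop (𝓝 0))
    (h2 : Tendsto (fun j => eLpNorm (g j - w) 2 volume) atTop (𝓝 0)) : u = w := by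
  have h3 : eLpNorm (u - w) 2 volume = 0 := by
    refine le_antisymm (ge_of_tendsto' (by simpa using h1.add h2) fun j => ?_) zero_le
    rw [eLpNorm_sub_comm (g j) u]
    have e : u - w = (u - g j) + (g j - w) := by abel
    rw [e]
    exact eLpNorm_add_le (hu.sub (hg j)).aestronglyMeasurable
      ((hg j).sub hw).aestronglyMeasurable (by norm_num)
  rw [eLpNorm_eq_zero_iff (hu.sub hw).aestronglyMeasurable two_ne_zero] at h3
  refine (hu.ae_eq_iff_eq volume hw).1 ?_
  filter_upwards [h3] with x hx
  simpa [sub_eq_zero] using hx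

section SphericalMean

variable {q : ℕ} {F G : Type*} [NormedAddCommGroup F] [NormedSpace ℝ F]
  [NormedAddCommGroup G] [NormedSpace ℝ G]

/-- The weighted mean of `f` over the sphere of radius `t` and centre `x`. -/
noncomputable def sphericalMean (t : ℝ) (S : EucSpace q → F →L[ℝ] G) (f : EucSpace q → F)
    (x : EucSpace q) : G :=
  ∫ θ, S θ (f (x + t • θ)) ∂sphereMeasure q

theorem sphericalMean_congr (hq : 1 ≤ q) {t : ℝ} (ht : 0 < t) (S : EucSpace q → F →L[ℝ] G)
    {f g : EucSpace q → F} {p : EucSpace q} (h : ∀ x ∈ Metric.sphere p t, f x = g x) :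
    sphericalMean t S f p = sphericalMean t S g p := by
  refine integral_congr_ae ?_
  filter_upwards [ae_sphereMeasure_norm_eq_one hq] with θ hθ
  rw [h]
  simp [norm_smul, hθ, abs_of_pos ht]

theorem continuous_sphericalMean (hq : 1 ≤ q) (t : ℝ) {S : EucSpace q → F →L[ℝ] G}
    (hS : Continuous S) {f : EucSpace q → F} (hf : Continuous f) :
    Continuous (sphericalMean t S f) := by
  have h : (sphereMeasure q).restrict (Metric.sphere 0 1) = sphereMeasure q := by
    refine Measure.restrict_eq_self_of_ae_mem ?_
    filter_upwards [ae_sphereMeasure_norm_eq_one hq] with θ hθ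
    simpa using hθ
  have hc : Continuous fun z : EucSpace q × EucSpace q => S z.2 (f (z.1 + t • z.2)) :=
    (hS.comp continuous_snd).clm_apply (hf.comp (by fun_prop))
  have := continuous_parametric_integral_of_continuous (μ := sphereMeasure q)
    (f := fun x θ => S θ (f (x + t • θ))) hc (isCompact_sphere 0 1)
  rw [h] at this
  exact this

theorem sphericalMean_sub (hq : 1 ≤ q) (t : ℝ) {S : EucSpace q → F →L[ℝ] G}
    (hS : Continuous S) {f g : EucSpace q → F} (hf : Continuous f) (hg : Continuous g) :
    sphericalMean t S (f - g) = sphericalMean t S f - sphericalMean t S g := by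
  funext x
  have h : ∀ {f : EucSpace q → F}, Continuous f →
      Integrable (fun θ => S θ (f (x + t • θ))) (sphereMeasure q) := fun hf =>
    integrable_sphereMeasure_of_continuous hq (hS.clm_apply (hf.comp (by fun_prop)))
  simp only [sphericalMean, Pi.sub_apply, map_sub]
  exact integral_sub (h hf) (h hg)

/-- Jensen on the sphere, then Tonelli and translation invariance of Lebesgue measure. This bound is
what carries the formula from test forms to the L² closure. -/
theorem lintegral_enorm_sq_sphericalMean_le (hq : 1 ≤ q) (t : ℝ) {S : EucSpace q → F →L[ℝ] G}
    {C : NNReal} (hC : ∀ θ, ‖θ‖ = 1 → ‖S θ‖₊ ≤ C) {f : EucSpace q → F} (hf : Continuous f) :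
    ∫⁻ x, ‖sphericalMean t S f x‖ₑ ^ (2 : ℝ) ≤ (C : ENNReal) ^ (2 : ℝ) * ∫⁻ x, ‖f x‖ₑ ^ (2 : ℝ) := by
  have h1 : ∀ x, ‖sphericalMean t S f x‖ₑ ≤ C * ∫⁻ θ, ‖f (x + t • θ)‖ₑ ∂sphereMeasure q := by
    intro x
    refine (enorm_integral_le_lintegral_enorm _).trans ?_
    rw [← lintegral_const_mul' _ _ ENNReal.coe_ne_top]
    refine lintegral_mono_ae ?_
    filter_upwards [ae_sphereMeasure_norm_eq_one hq] with θ hθ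
    refine (ContinuousLinearMap.le_opENorm _ _).trans ?_
    gcongr
    exact_mod_cast hC θ hθ
  have h2 : ∀ x, (∫⁻ θ, ‖f (x + t • θ)‖ₑ ∂sphereMeasure q) ^ (2 : ℝ) ≤
      ∫⁻ θ, ‖f (x + t • θ)‖ₑ ^ (2 : ℝ) ∂sphereMeasure q := by
    intro x
    have hm : AEStronglyMeasurable (fun θ => f (x + t • θ)) (sphereMeasure q) :=
      (hf.comp (by fun_prop : Continuous fun θ : EucSpace q => x + t • θ)).aestronglyMeasurable
    -- On a probability space the L¹ norm is at most the L² norm.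
    have := eLpNorm_le_eLpNorm_of_exponent_le (p := 1) (q := ((2 : NNReal) : ENNReal))
      (by norm_num) hm
    rw [eLpNorm_one_eq_lintegral_enorm] at this
    have h3 := eLpNorm_nnreal_pow_eq_lintegral (f := fun θ => f (x + t • θ))
      (μ := sphereMeasure q) (p := 2) two_ne_zero
    simp only [NNReal.coe_ofNat] at h3
    rw [← h3]
    gcongr
  calc ∫⁻ x, ‖sphericalMean t S f x‖ₑ ^ (2 : ℝ)
      ≤ ∫⁻ x, (C : ENNReal) ^ (2 : ℝ) * ∫⁻ θ, ‖f (x + t • θ)‖ₑ ^ (2 : ℝ) ∂sphereMeasure q := by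
        refine lintegral_mono fun x => ?_
        calc _ ≤ (C * ∫⁻ θ, ‖f (x + t • θ)‖ₑ ∂sphereMeasure q) ^ (2 : ℝ) := by
              gcongr; exact h1 x
          _ ≤ _ := by
              rw [ENNReal.mul_rpow_of_nonneg _ _ zero_le_two]
              gcongr
              exact h2 x
    _ = (C : ENNReal) ^ (2 : ℝ) *
        ∫⁻ x, ∫⁻ θ, ‖f (x + t • θ)‖ₑ ^ (2 : ℝ) ∂sphereMeasure q := by
        rw [lintegral_const_mul']
        simp
    _ = (C : ENNReal) ^ (2 : ℝ) *
        ∫⁻ θ, (∫⁻ x, ‖f (x + t • θ)‖ₑ ^ (2 : ℝ)) ∂sphereMeasure q := by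
        rw [lintegral_lintegral_swap]
        have : Continuous fun z : EucSpace q × EucSpace q => ‖f (z.1 + t • z.2)‖ₑ ^ (2 : ℝ) :=
          (ENNReal.continuous_rpow_const).comp
            (hf.comp (by fun_prop : Continuous fun z : EucSpace q × EucSpace q =>
              z.1 + t • z.2)).enorm
        exact this.measurable.aemeasurable
    _ = _ := by
        congr 1
        -- After translation the inner integral no longer depends on θ, and the sphere has total
        -- mass 1.
        simp only [lintegral_add_right_eq_self (μ := (volume : Measure (EucSpace q)))
          (fun x => ‖f x‖ₑ ^ (2 : ℝ))]
        simp

theorem eLpNorm_sphericalMean_le (hq : 1 ≤ q) (t : ℝ) {S : EucSpace q → F →L[ℝ] G}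
    {C : NNReal} (hC : ∀ θ, ‖θ‖ = 1 → ‖S θ‖₊ ≤ C) {f : EucSpace q → F} (hf : Continuous f) :
    eLpNorm (sphericalMean t S f) 2 volume ≤ C * eLpNorm f 2 volume := by
  have h := lintegral_enorm_sq_sphericalMean_le hq t hC hf
  have e1 := eLpNorm_nnreal_pow_eq_lintegral (f := sphericalMean t S f)
      (μ := (volume : Measure (EucSpace q))) (p := 2) two_ne_zero
  have e2 := eLpNorm_nnreal_pow_eq_lintegral (f := f)
      (μ := (volume : Measure (EucSpace q))) (p := 2) two_ne_zero
  simp only [NNReal.coe_ofNat, ENNReal.coe_ofNat] at e1 e2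
  rw [← e1, ← e2, ← ENNReal.mul_rpow_of_nonneg _ _ zero_le_two,
    ENNReal.rpow_le_rpow_iff zero_lt_two] at h
  exact h

theorem exists_bound_on_sphere {S : EucSpace q → F →L[ℝ] G} (hS : Continuous S) :
    ∃ C : NNReal, ∀ θ, ‖θ‖ = 1 → ‖S θ‖₊ ≤ C := by
  obtain ⟨C, hC⟩ := (isCompact_sphere (0 : EucSpace q) 1).exists_bound_of_continuousOn
    hS.continuousOn
  refine ⟨C.toNNReal, fun θ hθ => ?_⟩
  rw [← NNReal.coe_le_coe, coe_nnnorm]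
  exact (hC θ (by simpa using hθ)).trans (Real.le_coe_toNNReal C)

theorem memLp_sphericalMean (hq : 1 ≤ q) (t : ℝ) {S : EucSpace q → F →L[ℝ] G}
    (hS : Continuous S) {f : EucSpace q → F} (hf : Continuous f) (hf2 : MemLp f 2 volume) :
    MemLp (sphericalMean t S f) 2 volume := by
  obtain ⟨C, hC⟩ := exists_bound_on_sphere hS
  exact ⟨(continuous_sphericalMean hq t hS hf).aestronglyMeasurable,
    (eLpNorm_sphericalMean_le hq t hC hf).trans_lt (ENNReal.mul_lt_top ENNReal.coe_lt_top hf2.2)⟩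

theorem tendsto_eLpNorm_sphericalMean_sub (hq : 1 ≤ q) (t : ℝ) {S : EucSpace q → F →L[ℝ] G}
    (hS : Continuous S) {f : EucSpace q → F} (hf : Continuous f) {g : ℕ → EucSpace q → F}
    (hg : ∀ j, Continuous (g j))
    (h : Tendsto (fun j => eLpNorm (g j - f) 2 volume) atTop (𝓝 0)) :
    Tendsto (fun j => eLpNorm (sphericalMean t S (g j) - sphericalMean t S f) 2 volume) atTop
      (𝓝 0) := by
  obtain ⟨C, hC⟩ := exists_bound_on_sphere hS
  have h0 : Tendsto (fun j => C * eLpNorm (g j - f) 2 volume) atTop (𝓝 0) := by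
    simpa using ENNReal.Tendsto.const_mul h (Or.inr ENNReal.coe_ne_top)
  refine tendsto_of_tendsto_of_tendsto_of_le_of_le tendsto_const_nhds h0 (fun _ => zero_le)
    fun j => ?_
  simp only [← sphericalMean_sub hq t hS (hg j) hf]
  exact eLpNorm_sphericalMean_le hq t hC ((hg j).sub hf)

theorem exists_seq_contDiff_tendsto_eLpNorm_sub {f : EucSpace q → F} (hf : MemLp f 2 volume) :
    ∃ g : ℕ → EucSpace q → F, (∀ j, ContDiff ℝ ∞ (g j) ∧ HasCompactSupport (g j)) ∧
      Tendsto (fun j => eLpNorm (g j - f) 2 volume) atTop (𝓝 0) := by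
  have h : ∀ j : ℕ, ∃ g : EucSpace q → F, HasCompactSupport g ∧ ContDiff ℝ ∞ g ∧
      eLpNorm (f - g) 2 volume ≤ ENNReal.ofReal (1 / ((j : ℝ) + 1)) := fun j =>
    hf.exist_eLpNorm_sub_le ENNReal.ofNat_ne_top (by norm_num) (by positivity)
  choose g hg1 hg2 hg3 using h
  refine ⟨g, fun j => ⟨hg2 j, hg1 j⟩, ?_⟩
  have h0 : Tendsto (fun j : ℕ => ENNReal.ofReal (1 / ((j : ℝ) + 1))) atTop (𝓝 0) := by
    simpa using ENNReal.tendsto_ofReal tendsto_one_div_add_atTop_nhds_zero_nat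
  refine tendsto_of_tendsto_of_tendsto_of_le_of_le tendsto_const_nhds h0 (fun _ => zero_le)
    fun j => ?_
  simp only [eLpNorm_sub_comm (g j) f]
  exact hg3 j

/-! ### First-order data on the wave front. -/

/-- Vanishing on the sphere kills the tangential derivatives, and `hn` kills the normal one; the two
kinds of direction span the space. -/
theorem fderiv_eq_zero_of_eq_zero_on_sphere {t : ℝ} (ht : 0 < t) {h : EucSpace q → F}
    {p x : EucSpace q} (hd : DifferentiableAt ℝ h x) (hx : x ∈ Metric.sphere p t)
    (h0 : ∀ y ∈ Metric.sphere p t, h y = 0) (hn : fderiv ℝ h x (x - p) = 0) :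
    fderiv ℝ h x = 0 := by
  set n := x - p with hn'
  have hnt : ‖n‖ = t := by simpa [dist_eq_norm] using hx
  have tang : ∀ v, inner ℝ n v = 0 → ‖v‖ = t → fderiv ℝ h x v = 0 := by
    intro v hv hvt
    -- A great circle through `x` with velocity `v`: it stays on the sphere because `v` is
    -- orthogonal to `n` and has the same length `t`.
    have hγ : HasDerivAt (fun s : ℝ => p + (Real.cos s • n + Real.sin s • v)) v 0 := by
      have := (((Real.hasDerivAt_cos 0).smul_const n).add
        ((Real.hasDerivAt_sin 0).smul_const v)).const_add p
      simpa using this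
    have hγ0 : p + (Real.cos 0 • n + Real.sin 0 • v) = x := by simp [hn']
    have h1 := HasFDerivAt.comp_hasDerivAt (f := fun s : ℝ => p + (Real.cos s • n + Real.sin s • v))
      (l := h) (l' := fderiv ℝ h x) 0 (by simpa only [hγ0] using hd.hasFDerivAt) hγ
    have h2 : (h ∘ fun s : ℝ => p + (Real.cos s • n + Real.sin s • v)) = fun _ => 0 := by
      funext s
      refine h0 _ ?_
      rw [mem_sphere_iff_norm, add_sub_cancel_left]
      have h3 : ‖Real.cos s • n + Real.sin s • v‖ ^ 2 = t ^ 2 := by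
        rw [norm_add_sq_real, norm_smul, norm_smul, real_inner_smul_left, real_inner_smul_right, hv,
          hnt, hvt, mul_pow, mul_pow, Real.norm_eq_abs, Real.norm_eq_abs, sq_abs, sq_abs]
        linear_combination t ^ 2 * Real.sin_sq_add_cos_sq s
      exact (sq_eq_sq₀ (norm_nonneg _) ht.le).1 h3
    rw [h2] at h1
    exact h1.unique (hasDerivAt_const 0 (0 : F))
  have tang' : ∀ v, inner ℝ n v = 0 → fderiv ℝ h x v = 0 := by
    intro v hv
    rcases eq_or_ne v 0 with rfl | hv0
    · simp
    have hvn : ‖v‖ ≠ 0 := norm_ne_zero_iff.2 hv0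
    have := tang ((t / ‖v‖) • v) (by rw [real_inner_smul_right, hv, mul_zero])
      (by rw [norm_smul, Real.norm_of_nonneg (by positivity)]; field_simp)
    rw [map_smul, smul_eq_zero] at this
    exact this.resolve_left (div_ne_zero ht.ne' hvn)
  refine ContinuousLinearMap.ext fun v => ?_
  have hdec : v = (inner ℝ n v / t ^ 2) • n + (v - (inner ℝ n v / t ^ 2) • n) := by abel
  rw [hdec, map_add, map_smul, hn, smul_zero, zero_add, tang']
  · rfl
  · rw [inner_sub_right, real_inner_smul_right, real_inner_self_eq_norm_sq, hnt]
    field_simp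
    ring

end SphericalMean

/-! ### Passage to the L² closure and the theorem. -/

theorem isL2Extension_sphericalMean {q k l : ℕ} (hq : 1 ≤ q) (t : ℝ)
    {T : (EucSpace q → KForm q k) → (EucSpace q → KForm q l)}
    {S : EucSpace q → KForm q k →L[ℝ] KForm q l} (hS : Continuous S)
    (hT : ∀ g, IsTestForm g → T g = sphericalMean t S g) {f : EucSpace q → KForm q k}
    (hf : Continuous f) (hf2 : MemLp f 2 volume) : IsL2Extension T f (sphericalMean t S f) := by
  obtain ⟨g, hg, hgf⟩ := exists_seq_contDiff_tendsto_eLpNorm_sub hf2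
  refine ⟨hf2, memLp_sphericalMean hq t hS hf hf2, g, hg, hgf, ?_⟩
  simp only [fun j => hT (g j) (hg j)]
  exact tendsto_eLpNorm_sphericalMean_sub hq t hS hf (fun j => (hg j).1.continuous) hgf

/-- Whichever approximating sequence realises the closure, its images are spherical means, so they
also converge in L² to the mean of `f`. -/
theorem IsL2Extension.eq_sphericalMean {q k l : ℕ} (hq : 1 ≤ q) {t : ℝ}
    {T : (EucSpace q → KForm q k) → (EucSpace q → KForm q l)}
    {S : EucSpace q → KForm q k →L[ℝ] KForm q l} (hS : Continuous S)
    (hT : ∀ g, IsTestForm g → T g = sphericalMean t S g) {f : EucSpace q → KForm q k}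
    {u : EucSpace q → KForm q l} (hf : Continuous f) (hu : Continuous u)
    (h : IsL2Extension T f u) : u = sphericalMean t S f := by
  obtain ⟨_, _, g, hg, hgf, hgu⟩ := h
  simp only [fun j => hT (g j) (hg j)] at hgu
  exact eq_of_tendsto_eLpNorm_sub hu (continuous_sphericalMean hq t hS hf)
    (fun j => continuous_sphericalMean hq t hS (hg j).1.continuous) hgu
    (tendsto_eLpNorm_sphericalMean_sub hq t hS hf (fun j => (hg j).1.continuous) hgf)

theorem existsUnique_continuous_isL2Extension {q k l : ℕ} (hq : 1 ≤ q) (t : ℝ)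
    {T : (EucSpace q → KForm q k) → (EucSpace q → KForm q l)}
    {S : EucSpace q → KForm q k →L[ℝ] KForm q l} (hS : Continuous S)
    (hT : ∀ g, IsTestForm g → T g = sphericalMean t S g) {f : EucSpace q → KForm q k}
    (hf : Continuous f) (hf2 : MemLp f 2 volume) :
    ∃! u : EucSpace q → KForm q l, Continuous u ∧ IsL2Extension T f u :=
  ⟨sphericalMean t S f, ⟨continuous_sphericalMean hq t hS hf,
    isL2Extension_sphericalMean hq t hS hT hf hf2⟩,
    fun _ hu => hu.2.eq_sphericalMean hq hS hT hf hu.1⟩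

theorem continuous_extDeriv {q k : ℕ} {f : EucSpace q → KForm q k} (hf : ContDiff ℝ 1 f) :
    Continuous (extDeriv f) :=
  (ContinuousAlternatingMap.alternatizeUncurryFinCLM ℝ (EucSpace q) ℂ).continuous.comp
    (hf.continuous_fderiv one_ne_zero)

theorem theorem2 (q : ℕ) (hq : 1 ≤ q) (k : ℕ) (t : ℝ) (ht : 0 < t) :
    ((∀ f : EucSpace q → KForm q k, Continuous f → MemLp f 2 volume →
        ∃! u : EucSpace q → KForm q (k + 1),
          Continuous u ∧ IsL2Extension (deformedExtDeriv t) f u) ∧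
      (∀ (f₁ f₂ : EucSpace q → KForm q k) (u₁ u₂ : EucSpace q → KForm q (k + 1)),
        Continuous f₁ → Continuous f₂ → Continuous u₁ → Continuous u₂ →
        IsL2Extension (deformedExtDeriv t) f₁ u₁ →
        IsL2Extension (deformedExtDeriv t) f₂ u₂ →
        ∀ p : EucSpace q, (∀ x ∈ Metric.sphere p t, f₁ x = f₂ x) → u₁ p = u₂ p)) ∧
    ((∀ f : EucSpace q → KForm q k, ContDiff ℝ 1 f → MemLp (extDeriv f) 2 volume →
        ∃! u : EucSpace q → KForm q (k + 1),
          Continuous u ∧ IsL2Extension (evenDiracCalculus (besselPhi q) t) (extDeriv f) u) ∧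
      (∀ (f₁ f₂ : EucSpace q → KForm q k) (u₁ u₂ : EucSpace q → KForm q (k + 1)),
        ContDiff ℝ 1 f₁ → ContDiff ℝ 1 f₂ → Continuous u₁ → Continuous u₂ →
        IsL2Extension (evenDiracCalculus (besselPhi q) t) (extDeriv f₁) u₁ →
        IsL2Extension (evenDiracCalculus (besselPhi q) t) (extDeriv f₂) u₂ →
        ∀ p : EucSpace q,
          (∀ x ∈ Metric.sphere p t,
            f₁ x = f₂ x ∧ fderiv ℝ f₁ x (x - p) = fderiv ℝ f₂ x (x - p)) →
          u₁ p = u₂ p)) := by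
  have hSa := continuous_gradSymbol
    (ContinuousAlternatingMap.alternatizeUncurryFinCLM ℝ (n := k) (EucSpace q) ℂ)
  have hTa : ∀ g : EucSpace q → KForm q k, IsTestForm g → deformedExtDeriv t g =
      sphericalMean t (gradSymbol
        (ContinuousAlternatingMap.alternatizeUncurryFinCLM ℝ (EucSpace q) ℂ)) g :=
    fun g hg => deformedExtDeriv_eq hq ht hg
  have hSb : Continuous fun _ : EucSpace q => ContinuousLinearMap.id ℝ (KForm q (k + 1)) :=
    continuous_const
  have hTb : ∀ g : EucSpace q → KForm q (k + 1), IsTestForm g →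
      evenDiracCalculus (besselPhi q) t g =
        sphericalMean t (fun _ => ContinuousLinearMap.id ℝ (KForm q (k + 1))) g :=
    fun g hg => evenDiracCalculus_besselPhi_eq hq ht hg
  refine ⟨⟨fun f hf hf2 => existsUnique_continuous_isL2Extension hq t hSa hTa hf hf2, ?_⟩,
    fun f hf hf2 => existsUnique_continuous_isL2Extension hq t hSb hTb (continuous_extDeriv hf) hf2,
    ?_⟩
  · intro f₁ f₂ u₁ u₂ hf₁ hf₂ hu₁ hu₂ h₁ h₂ p hp
    rw [h₁.eq_sphericalMean hq hSa hTa hf₁ hu₁, h₂.eq_sphericalMean hq hSa hTa hf₂ hu₂]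
    exact sphericalMean_congr hq ht _ hp
  · intro f₁ f₂ u₁ u₂ hf₁ hf₂ hu₁ hu₂ h₁ h₂ p hp
    rw [h₁.eq_sphericalMean hq hSb hTb (continuous_extDeriv hf₁) hu₁,
      h₂.eq_sphericalMean hq hSb hTb (continuous_extDeriv hf₂) hu₂]
    refine sphericalMean_congr hq ht _ fun x hx => ?_
    have d₁ := hf₁.differentiable one_ne_zero
    have d₂ := hf₂.differentiable one_ne_zero
    -- The mean for b) involves only the exterior derivatives on the sphere, so it is enough that
    -- the full derivatives of `f₁` and `f₂` agree there.
    have h := fderiv_eq_zero_of_eq_zero_on_sphere ht (h := f₁ - f₂) ((d₁ x).sub (d₂ x)) hx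
      (fun y hy => by simp [(hp y hy).1])
      (by rw [fderiv_sub (d₁ x) (d₂ x), sub_apply, (hp x hx).2, sub_self])
    rw [fderiv_sub (d₁ x) (d₂ x), sub_eq_zero] at h
    rw [extDeriv, extDeriv, h]
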